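/- Let $\mathfrak g$ be a finite-dimensional simple Lie algebra over $\mathbb C$ with Cartan subalgebra $\mathfrak h$, a chosen base of simple roots $\alpha_i$, highest root $\theta$, half-sum of positive roots $\rho$, and dominant integral weights $P_+=\{\lambda\in\mathfrak h^*:\ 2\langle\lambda,\alpha_i\rangle/\langle\alpha_i,\alpha_i\rangle\in\mathbb N\text{ for all }i\}$, where $\mathbb N=\{0,1,2,\dots\}$ and $\langle\cdot,\cdot\rangle$ is the nondegenerate invariant bilinear form on $\mathfrak g$ (and the induced form on $\mathfrak h^*$) normalized so that long roots have squared length $2$ (equivalently, $\langle\theta,\theta\rangle=2$). Let $h^\vee$ be the dual Coxeter number, i.e. the Casimir element acts on the adjoint representation by the scalar $2h^\vee$, and for $\lambda\in P_+$ and $\ell\in\mathbb N$ put $$h_{\lambda,\ell}=\frac{\langle\lambda,\lambda+2\rho\rangle}{2(\ell+h^\vee)}.$$ Let $\widetilde{\mathfrak g}=\mathfrak g\otimes\mathbb C[t,t^{-1}]\oplus\mathbb C\mathbf k\oplus\mathbb C\mathbf d$ be the affine Kac-Moody Lie algebra, where $\mathbf k$ is central, $[a\otimes t^m,b\otimes t^n]=[a,b]\otimes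 t^{m+n}+m\langle a,b\rangle\delta_{m+n,0}\mathbf k$ and $[\mathbf d,a\otimes t^n]=n\,a\otimes t^n$, with Cartan subalgebra $\mathfrak H=\mathfrak h\oplus\mathbb C\mathbf k\oplus\mathbb C\mathbf d$; let $\mathbf k',\mathbf d'\in\mathfrak H^*$ vanish on $\mathfrak h$ and be dual to $\mathbf k,\mathbf d$, and extend elements of $\mathfrak h^*$ to $\mathfrak H$ by zero on $\mathbf k$ and $\mathbf d$. For a dominant integral weight $\Lambda\in\mathfrak H^*$ let $L(\Lambda)$ be the standard module, that is, the irreducible $\widetilde{\mathfrak g}$-module with highest weight $\Lambda$ (with respect to the positive root vectors: the $x\otimes t^0$ with $x$ in a positive root space of $\mathfrak g$, and the $x\otimes t^n$ with $x\in\mathfrak g$, $n>0$). Let $\ell\in\mathbb N$, let $\lambda\in P_+$ satisfy $\langle\lambda,\theta\rangle\le\ell$, and let $\Lambda=\lambda+\ell\mathbf k'-h_{\lambda,\ell}\mathbf d'$. If $\Lambda'=\lambda'+\ell\mathbf k'-(h_{\lambda',\ell}-m)\mathbf d'$ is a weight of $L(\Lambda)$ with $\lambda'\in P_+$ and $m\in\mathbb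 N$, then $\Lambda'=\Lambda$. -/

import Mathlib

namespace AffineLie

open scoped TensorProduct
open Module LieAlgebra LieAlgebra.IsKilling

noncomputable section

section Finite

variable {𝔤 : Type*} [LieRing 𝔤] [LieAlgebra ℂ 𝔤] [FiniteDimensional ℂ 𝔤]
  [LieAlgebra.IsSimple ℂ 𝔤] {𝔥 : LieSubalgebra ℂ 𝔤} [𝔥.IsCartanSubalgebra]

/-- The factor by which the Killing form `κ` has to be rescaled so that the induced form on `𝔥*`
gives the root `θ` squared length `2` (see `dualForm_self`). -/
def formScale (θ : 𝔥.root) : ℂ :=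
  2 / killingForm ℂ 𝔤 (coroot θ.1 : 𝔤) (coroot θ.1 : 𝔤)

/-- The invariant bilinear form `⟨·,·⟩` on the simple Lie algebra `𝔤`, normalised by `⟨θ, θ⟩ = 2`.
It is used with `θ` the highest root, which is a long root, so all long roots have squared
length `2`. (Every invariant form on `𝔤` is a multiple of the Killing form.) -/
def form (θ : 𝔥.root) : LinearMap.BilinForm ℂ 𝔤 := formScale θ • killingForm ℂ 𝔤

lemma killingForm_coroot_ne_zero (θ : 𝔥.root) :
    killingForm ℂ 𝔤 (coroot θ.1 : 𝔤) (coroot θ.1 : 𝔤) ≠ 0 := by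
  have hθ : θ.1.IsNonZero := LieSubalgebra.isNonZero_coe_root θ
  have h := traceForm_coroot θ.1 (coroot θ.1)
  rw [root_apply_coroot hθ] at h
  have h' : killingForm ℂ 𝔤 (coroot θ.1 : 𝔤) (coroot θ.1 : 𝔤) =
    LieModule.traceForm ℂ 𝔥 𝔤 (coroot θ.1) (coroot θ.1) := rfl
  rw [h', h]
  have := root_apply_cartanEquivDual_symm_ne_zero hθ
  simp [this]

lemma formScale_ne_zero (θ : 𝔥.root) : formScale θ ≠ 0 :=
  div_ne_zero two_ne_zero (killingForm_coroot_ne_zero θ)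

lemma form_isSymm (θ : 𝔥.root) : (form θ).IsSymm :=
  ⟨fun x y ↦ by simp [form, LieModule.traceForm_comm ℂ 𝔤 𝔤 x y]⟩

lemma form_lieInvariant (θ : 𝔥.root) : (form θ).lieInvariant 𝔤 := by
  intro x y z
  have := LieModule.traceForm_lieInvariant ℂ 𝔤 𝔤 x y z
  simp only [form, LinearMap.smul_apply, smul_eq_mul] at *
  rw [this]; ring

lemma form_neg_isSymm (θ : 𝔥.root) : (-form θ).IsSymm :=
  ⟨fun x y ↦ by simp [(form_isSymm θ).eq x y]⟩

lemma form_neg_lieInvariant (θ : 𝔥.root) : (-form θ).lieInvariant 𝔤 := by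
  intro x y z
  simp [form_lieInvariant θ x y z]

lemma form_nondegenerate (θ : 𝔥.root) : (form θ).Nondegenerate := by
  have h := LieAlgebra.IsKilling.killingForm_nondegenerate ℂ 𝔤
  refine ⟨fun x hx ↦ h.1 x fun y ↦ ?_, fun x hx ↦ h.2 x fun y ↦ ?_⟩
  · simpa [form, formScale_ne_zero θ] using hx y
  · simpa [form, formScale_ne_zero θ] using hx y

/-- The form `⟨·,·⟩` on `𝔥*` induced by the restriction of `form θ` to `𝔥`; see `dualForm_form`.
`cartanEquivDual` is the isomorphism `𝔥 ≃ 𝔥*` given by the Killing form. -/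
def dualForm (θ : 𝔥.root) : LinearMap.BilinForm ℂ (Dual ℂ 𝔥) :=
  (formScale θ)⁻¹ • (LinearMap.id.compl₂ ((cartanEquivDual 𝔥).symm : Dual ℂ 𝔥 →ₗ[ℂ] 𝔥))

/-- `dualForm θ` is the transport of `form θ` along `x ↦ ⟨x, ·⟩`. -/
lemma dualForm_form (θ : 𝔥.root) (x y : 𝔥) :
    dualForm θ ((form θ x).comp 𝔥.toSubmodule.subtype) ((form θ y).comp 𝔥.toSubmodule.subtype) =
      form θ x y := by
  have key (z : 𝔥) : (form θ z).comp 𝔥.toSubmodule.subtype =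
      formScale θ • cartanEquivDual 𝔥 z := by ext w; rfl
  rw [dualForm, key y]
  simp [formScale_ne_zero θ]
  rfl

lemma dualForm_self (θ : 𝔥.root) : dualForm θ θ.1.toLinear θ.1.toLinear = 2 := by
  have hθ : θ.1.IsNonZero := LieSubalgebra.isNonZero_coe_root θ
  have h := traceForm_coroot θ.1 (coroot θ.1)
  rw [root_apply_coroot hθ] at h
  have h' : killingForm ℂ 𝔤 (coroot θ.1 : 𝔤) (coroot θ.1 : 𝔤) =
    LieModule.traceForm ℂ 𝔥 𝔤 (coroot θ.1) (coroot θ.1) := rfl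
  have := root_apply_cartanEquivDual_symm_ne_zero hθ
  simp [dualForm, formScale, h', h]
  field_simp

/-- The action on the adjoint representation of the Casimir element `∑ i, γ i * γ' i`, where `γ` is a
basis of `𝔤` and `γ'` its dual basis for the normalised form. -/
def casimirAd (θ : 𝔥.root) : Module.End ℂ 𝔤 :=
  ∑ i, (ad ℂ 𝔤 (finBasis ℂ 𝔤 i)) ∘ₗ
    (ad ℂ 𝔤 ((form θ).dualBasis (form_nondegenerate θ) (finBasis ℂ 𝔤) i))

/-- The dual Coxeter number `h^∨`: the Casimir element acts on the adjoint representation by a scalar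
(its trace divided by the dimension), and that scalar is `2 h^∨`; see `casimirAd_apply`. -/
def dualCoxeter (θ : 𝔥.root) : ℂ :=
  LinearMap.trace ℂ 𝔤 (casimirAd θ) / (2 * finrank ℂ 𝔤)

lemma casimirAd_eq_scale (θ : 𝔥.root) (x : 𝔤) : casimirAd θ x = (formScale θ)⁻¹ • x := by
  have hK := LieAlgebra.IsKilling.killingForm_nondegenerate ℂ 𝔤
  have hinv := LieModule.traceForm_lieInvariant ℂ 𝔤 𝔤
  refine sub_eq_zero.1 (hK.1 _ fun y ↦ ?_)
  set γ := finBasis ℂ 𝔤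
  set δ := (form θ).dualBasis (form_nondegenerate θ) γ
  have hcoord (i) (z : 𝔤) : γ.repr z i = formScale θ * killingForm ℂ 𝔤 z (δ i) := by
    have := LinearMap.BilinForm.dualBasis_repr_apply (form_nondegenerate θ) δ z i
    rw [show (form θ).dualBasis (form_nondegenerate θ) δ = γ from
      LinearMap.BilinForm.dualBasis_dualBasis (form_nondegenerate θ) (form_isSymm θ) γ] at this
    rw [this]; rfl
  have htr : killingForm ℂ 𝔤 x y =
      ∑ i, formScale θ * killingForm ℂ 𝔤 ⁅x, ⁅y, γ i⁆⁆ (δ i) := by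
    rw [killingForm_apply_apply, LinearMap.trace_eq_matrix_trace ℂ γ, Matrix.trace]
    refine Finset.sum_congr rfl fun i _ ↦ ?_
    rw [Matrix.diag_apply, LinearMap.toMatrix_apply, hcoord]; rfl
  have hterm (i) : killingForm ℂ 𝔤 ⁅γ i, ⁅δ i, x⁆⁆ y = killingForm ℂ 𝔤 ⁅x, ⁅y, γ i⁆⁆ (δ i) := by
    have h1 := hinv (γ i) ⁅δ i, x⁆ y
    have h2 := hinv x ⁅y, γ i⁆ (δ i)
    rw [h1, h2, LieModule.traceForm_comm ℂ 𝔤 𝔤 ⁅δ i, x⁆, ← lie_skew y (γ i), ← lie_skew x (δ i)]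
    simp only [map_neg, LinearMap.neg_apply, neg_neg]
  simp only [map_sub, LinearMap.sub_apply, map_smul, LinearMap.smul_apply, htr]
  simp only [casimirAd, LinearMap.coe_sum, Finset.sum_apply, map_sum, LinearMap.comp_apply,
    ad_apply]
  rw [← Finset.mul_sum, smul_eq_mul, inv_mul_cancel_left₀ (formScale_ne_zero θ), sub_eq_zero]
  exact Finset.sum_congr rfl fun i _ ↦ hterm i

/-- The Casimir element acts on the adjoint representation as the scalar `2 h^∨`. -/
lemma casimirAd_apply (θ : 𝔥.root) (x : 𝔤) : casimirAd θ x = (2 * dualCoxeter θ) • x := by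
  have h : casimirAd θ = (formScale θ)⁻¹ • LinearMap.id := LinearMap.ext (casimirAd_eq_scale θ)
  have : Nontrivial 𝔤 := ⟨_, _, fun e ↦ killingForm_coroot_ne_zero θ (by
    rw [show (coroot θ.1 : 𝔤) = 0 from e]; simp)⟩
  have hn : (finrank ℂ 𝔤 : ℂ) ≠ 0 := by exact_mod_cast (finrank_pos (R := ℂ) (M := 𝔤)).ne'
  rw [dualCoxeter, h]
  simp only [map_smul, LinearMap.trace_id, LinearMap.smul_apply, LinearMap.id_apply, smul_eq_mul]
  congr 1
  field_simp

/-- The monoid `Q₊` of non-negative integral combinations of the simple roots. -/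
def Qplus (b : (rootSystem 𝔥).Base) : AddSubmonoid (Dual ℂ 𝔥) :=
  AddSubmonoid.closure ((rootSystem 𝔥).root '' b.support)

/-- Positive roots of `𝔤` with respect to the base `b`. -/
def IsPositive (b : (rootSystem 𝔥).Base) (α : 𝔥.root) : Prop := α.1.toLinear ∈ Qplus b

/-- `θ` is the highest root: `α ≺ θ`, that is `θ - α ∈ Q₊`, for every root `α`. -/
def IsHighestRoot (b : (rootSystem 𝔥).Base) (θ : 𝔥.root) : Prop :=
  ∀ α : 𝔥.root, θ.1.toLinear - α.1.toLinear ∈ Qplus b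

open scoped Classical in
/-- Half the sum of the positive roots. -/
def rho (b : (rootSystem 𝔥).Base) : Dual ℂ 𝔥 :=
  (2⁻¹ : ℂ) • ∑ α : 𝔥.root with IsPositive b α, α.1.toLinear

/-- The set `P₊` of dominant integral weights of `𝔤`: `2⟨μ, α_i⟩ / ⟨α_i, α_i⟩` is a non-negative
integer for every simple root `α_i`. -/
def dominantWeights (b : (rootSystem 𝔥).Base) (θ : 𝔥.root) : Set (Dual ℂ 𝔥) :=
  {μ | ∀ i ∈ b.support, ∃ n : ℕ,
    2 * dualForm θ μ i.1.toLinear / dualForm θ i.1.toLinear i.1.toLinear = n}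

/-- The lowest conformal weight `h_{μ,ℓ} = ⟨μ, μ + 2ρ⟩ / (2 (ℓ + h^∨))`. -/
def conformalWeight (b : (rootSystem 𝔥).Base) (θ : 𝔥.root) (μ : Dual ℂ 𝔥) (ℓ : ℕ) : ℂ :=
  dualForm θ μ (μ + (2 : ℂ) • rho b) / (2 * (ℓ + dualCoxeter θ))

/-- Equivalently, `μ` takes non-negative integral values on the simple coroots. -/
lemma dominantWeights_iff (b : (rootSystem 𝔥).Base) (θ : 𝔥.root) (μ : Dual ℂ 𝔥) :
    μ ∈ dominantWeights b θ ↔ ∀ i ∈ b.support, ∃ n : ℕ, μ (coroot i.1) = n := by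
  refine forall₂_congr fun i _ ↦ exists_congr fun n ↦ ?_
  have hi := root_apply_cartanEquivDual_symm_ne_zero (LieSubalgebra.isNonZero_coe_root i)
  have hs := formScale_ne_zero θ
  suffices 2 * dualForm θ μ i.1.toLinear / dualForm θ i.1.toLinear i.1.toLinear =
      μ (coroot i.1) by rw [this]
  simp [dualForm, coroot]
  field_simp

end Finite

section Loop

variable {𝔤 : Type*} [LieRing 𝔤] [LieAlgebra ℂ 𝔤]

variable (𝔤) in
/-- The operator `t d/dt` on the loop algebra `ℂ[t, t⁻¹] ⊗ 𝔤`. -/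
def loopDegree : loopAlgebra ℂ ℤ 𝔤 →ₗ[ℂ] loopAlgebra ℂ ℤ 𝔤 :=
  LinearMap.rTensor 𝔤 ((AddMonoidAlgebra.basis ℤ ℂ).constr ℂ
    fun n : ℤ ↦ (n : ℂ) • (AddMonoidAlgebra.single n 1 : AddMonoidAlgebra ℂ ℤ))

lemma loopDegree_tmul (n : ℤ) (x : 𝔤) :
    loopDegree 𝔤 (AddMonoidAlgebra.single n 1 ⊗ₜ[ℂ] x) =
      (n : ℂ) • (AddMonoidAlgebra.single n 1 ⊗ₜ[ℂ] x) := by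
  have := (AddMonoidAlgebra.basis ℤ ℂ).constr_basis ℂ
    (fun n : ℤ ↦ (n : ℂ) • (AddMonoidAlgebra.single n 1 : AddMonoidAlgebra ℂ ℤ)) n
  rw [AddMonoidAlgebra.basis_apply] at this
  rw [loopDegree, LinearMap.rTensor_tmul, this, TensorProduct.smul_tmul']

lemma loop_lie (m n : ℤ) (x y : 𝔤) :
    ⁅(AddMonoidAlgebra.single m 1 ⊗ₜ[ℂ] x : loopAlgebra ℂ ℤ 𝔤),
      (AddMonoidAlgebra.single n 1 ⊗ₜ[ℂ] y : loopAlgebra ℂ ℤ 𝔤)⁆ =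
      AddMonoidAlgebra.single (m + n) 1 ⊗ₜ[ℂ] ⁅x, y⁆ := by
  rw [LieAlgebra.ExtendScalars.bracket_tmul, AddMonoidAlgebra.single_mul_single, mul_one]

lemma residue_single (Φ : LinearMap.BilinForm ℂ 𝔤) (m n : ℤ) (x y : 𝔤) :
    LoopAlgebra.residuePairing ℂ ℤ 𝔤 Φ (AddMonoidAlgebra.single m 1 ⊗ₜ[ℂ] x)
      (AddMonoidAlgebra.single n 1 ⊗ₜ[ℂ] y) = if m + n = 0 then (n : ℂ) * Φ x y else 0 := by
  rw [LoopAlgebra.residuePairing_apply_apply]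
  simp only [LoopAlgebra.toFinsupp_single_tmul]
  rw [Finsupp.sum_single_index (by simp)]
  by_cases h : m + n = 0
  · have hm : m = -n := by omega
    simp [hm]
  · have : m ≠ -n := by omega
    simp [h, this]

@[elab_as_elim]
lemma loop_induction {p : loopAlgebra ℂ ℤ 𝔤 → Prop} (f : loopAlgebra ℂ ℤ 𝔤)
    (single : ∀ n x, p (AddMonoidAlgebra.single n 1 ⊗ₜ[ℂ] x))
    (add : ∀ f g, p f → p g → p (f + g)) : p f := by
  rw [← (LoopAlgebra.toFinsupp ℂ ℤ 𝔤).symm_apply_apply f]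
  induction LoopAlgebra.toFinsupp ℂ ℤ 𝔤 f using Finsupp.induction_linear with
  | zero => simpa using single 0 0
  | add f g hf hg => rw [map_add]; exact add _ _ hf hg
  | single n x => rw [LoopAlgebra.toFinsupp_symm_single]; exact single n x

lemma loopDegree_lie (f g : loopAlgebra ℂ ℤ 𝔤) :
    loopDegree 𝔤 ⁅f, g⁆ = ⁅f, loopDegree 𝔤 g⁆ - ⁅g, loopDegree 𝔤 f⁆ := by
  have ha (f g h : loopAlgebra ℂ ℤ 𝔤) : ⁅f + g, h⁆ = ⁅f, h⁆ + ⁅g, h⁆ := add_lie f g h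
  have hb (f g h : loopAlgebra ℂ ℤ 𝔤) : ⁅f, g + h⁆ = ⁅f, g⁆ + ⁅f, h⁆ := lie_add f g h
  have hc (c : ℂ) (f g : loopAlgebra ℂ ℤ 𝔤) : ⁅f, c • g⁆ = c • ⁅f, g⁆ := lie_smul c f g
  induction f using loop_induction with
  | add f₁ f₂ h₁ h₂ => rw [map_add, ha, hb, ha, map_add, h₁, h₂]; abel
  | single m x =>
    induction g using loop_induction with
    | add g₁ g₂ h₁ h₂ => rw [map_add, ha, hb, hb, map_add, h₁, h₂]; abel
    | single n y =>
      rw [loopDegree_tmul, loopDegree_tmul, hc, hc, loop_lie, loop_lie,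
        loopDegree_tmul, ← lie_skew x y, TensorProduct.tmul_neg, add_comm n m]
      push_cast
      module

lemma residue_loopDegree (Φ : LinearMap.BilinForm ℂ 𝔤) (hΦ : Φ.IsSymm) (f g : loopAlgebra ℂ ℤ 𝔤) :
    LoopAlgebra.residuePairing ℂ ℤ 𝔤 Φ f (loopDegree 𝔤 g) =
      LoopAlgebra.residuePairing ℂ ℤ 𝔤 Φ g (loopDegree 𝔤 f) := by
  induction f using loop_induction with
  | add f₁ f₂ h₁ h₂ => simp only [map_add, LinearMap.add_apply, h₁, h₂]
  | single m x =>
    induction g using loop_induction with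
    | add g₁ g₂ h₁ h₂ => simp only [map_add, LinearMap.add_apply, h₁, h₂]
    | single n y =>
      rw [loopDegree_tmul, loopDegree_tmul, map_smul, map_smul, residue_single, residue_single,
        hΦ.eq y x]
      by_cases h : m + n = 0
      · have hm : m = -n := by omega
        subst hm
        simp
      · simp [h, add_comm n m]

end Loop

section Affine

variable {𝔤 : Type*} [LieRing 𝔤] [LieAlgebra ℂ 𝔤] [FiniteDimensional ℂ 𝔤]
  [LieAlgebra.IsSimple ℂ 𝔤] {𝔥 : LieSubalgebra ℂ 𝔤} [𝔥.IsCartanSubalgebra]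

/-- The affine Lie algebra `𝔤 ⊗ ℂ[t, t⁻¹] ⊕ ℂ k`. Mathlib's cocycle attached to `Φ` sends
`(x ⊗ t^m, y ⊗ t^n)` to `n Φ(x, y) δ_{m+n,0}`, hence the sign: `m ⟨x, y⟩ = n (-⟨x, y⟩)` if
`m + n = 0`. See `lie_loopElt`. -/
abbrev AffineHat (θ : 𝔥.root) : Type _ :=
  LieAlgebra.ofTwoCocycle (LoopAlgebra.twoCocycleOfBilinear ℂ ℤ 𝔤 (-form θ)
    (form_neg_lieInvariant θ) (form_neg_isSymm θ))

/-- The derivation of the affine Lie algebra with `x ⊗ t^n ↦ n x ⊗ t^n` and `k ↦ 0`. -/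
def hatDegree (θ : 𝔥.root) : LieDerivation ℂ (AffineHat θ) (AffineHat θ) where
  toFun a := ⟨(loopDegree 𝔤 a.carrier.1, 0)⟩
  map_add' a b := congrArg LieAlgebra.ofTwoCocycle.mk
    (Prod.ext (map_add (loopDegree 𝔤) a.carrier.1 b.carrier.1) (add_zero 0).symm)
  map_smul' r a := congrArg LieAlgebra.ofTwoCocycle.mk
    (Prod.ext (map_smul (loopDegree 𝔤) r a.carrier.1) (smul_zero r).symm)
  leibniz' a b := by
    refine congrArg LieAlgebra.ofTwoCocycle.mk (Prod.ext ?_ ?_)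
    · exact loopDegree_lie a.carrier.1 b.carrier.1
    · have h := residue_loopDegree (-form θ) (form_neg_isSymm θ) a.carrier.1 b.carrier.1
      have hz (f : loopAlgebra ℂ ℤ 𝔤) (z : TrivialLieModule ℂ (loopAlgebra ℂ ℤ 𝔤) ℂ) :
        ⁅f, z⁆ = 0 := trivial_lie_zero ..
      refine Eq.trans ?_ (congrArg₂ (· - ·) (congrArg₂ (· - ·) (congrArg₂ (· + ·) rfl
        (hz a.carrier.1 0)) (hz (loopDegree 𝔤 b.carrier.1) a.carrier.2))
        (congrArg₂ (· - ·) (congrArg₂ (· + ·) rfl (hz b.carrier.1 0))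
        (hz (loopDegree 𝔤 a.carrier.1) b.carrier.2))).symm
      change (0 : TrivialLieModule ℂ (loopAlgebra ℂ ℤ 𝔤) ℂ) =
        ((TrivialLieModule.equiv ℂ _ ℂ).symm (LoopAlgebra.residuePairing ℂ ℤ 𝔤 (-form θ)
          a.carrier.1 (loopDegree 𝔤 b.carrier.1)) + 0 - 0) -
        ((TrivialLieModule.equiv ℂ _ ℂ).symm (LoopAlgebra.residuePairing ℂ ℤ 𝔤 (-form θ)
          b.carrier.1 (loopDegree 𝔤 a.carrier.1)) + 0 - 0)
      rw [h]
      abel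

attribute [local instance 100] LieRing.ofAssociativeRing

/-- The one-dimensional abelian Lie algebra `ℂ d` acting through `hatDegree`. -/
def degreeAction (θ : 𝔥.root) : ℂ →ₗ⁅ℂ⁆ LieDerivation ℂ (AffineHat θ) (AffineHat θ) where
  toFun z := z • hatDegree θ
  map_add' z w := add_smul z w _
  map_smul' z w := mul_smul z w _
  map_lie' {z w} := by
    have h : ⁅z, w⁆ = 0 := by rw [LieRing.of_associative_ring_bracket, mul_comm, sub_self]
    simp [h]

/-- The affine Kac-Moody Lie algebra: the semidirect product of the affine Lie algebra with `ℂ d`. -/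
abbrev AffineKM (θ : 𝔥.root) : Type _ := SemiDirectSum (AffineHat θ) ℂ (degreeAction θ)

/-- The element `x ⊗ t ^ n`. -/
def loopElt (θ : 𝔥.root) (n : ℤ) (x : 𝔤) : AffineKM θ :=
  ⟨⟨(AddMonoidAlgebra.single n 1 ⊗ₜ[ℂ] x, 0)⟩, 0⟩

/-- The central element `k`. -/
def centralElt (θ : 𝔥.root) : AffineKM θ :=
  ⟨⟨(0, (TrivialLieModule.equiv ℂ (loopAlgebra ℂ ℤ 𝔤) ℂ).symm 1)⟩, 0⟩

/-- The element `d`. -/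
def degreeElt (θ : 𝔥.root) : AffineKM θ := ⟨0, 1⟩

lemma loopElt_add (θ : 𝔥.root) (n : ℤ) (x y : 𝔤) :
    loopElt θ n (x + y) = loopElt θ n x + loopElt θ n y := by
  refine congrArg₂ SemiDirectSum.mk (congrArg LieAlgebra.ofTwoCocycle.mk (Prod.ext ?_ ?_)) ?_
  · exact TensorProduct.tmul_add ..
  · exact (add_zero 0).symm
  · exact (add_zero 0).symm

lemma loopElt_smul (θ : 𝔥.root) (n : ℤ) (c : ℂ) (x : 𝔤) :
    loopElt θ n (c • x) = c • loopElt θ n x := by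
  refine congrArg₂ SemiDirectSum.mk (congrArg LieAlgebra.ofTwoCocycle.mk (Prod.ext ?_ ?_)) ?_
  · exact TensorProduct.tmul_smul ..
  · exact (smul_zero c).symm
  · exact (smul_zero c).symm

lemma lie_loopElt (θ : 𝔥.root) (m n : ℤ) (x y : 𝔤) :
    ⁅loopElt θ m x, loopElt θ n y⁆ =
      loopElt θ (m + n) ⁅x, y⁆ + (if m + n = 0 then (m : ℂ) * form θ x y else 0) • centralElt θ := by
  have hz (f : loopAlgebra ℂ ℤ 𝔤) (z : TrivialLieModule ℂ (loopAlgebra ℂ ℤ 𝔤) ℂ) :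
    ⁅f, z⁆ = 0 := trivial_lie_zero ..
  have h0 (a : AffineHat θ) : degreeAction θ 0 a = 0 := by rw [map_zero]; rfl
  have key : ⁅(loopElt θ m x).left, (loopElt θ n y).left⁆ =
      (loopElt θ (m + n) ⁅x, y⁆ +
        (if m + n = 0 then (m : ℂ) * form θ x y else 0) • centralElt θ).left := by
    refine congrArg LieAlgebra.ofTwoCocycle.mk (Prod.ext ?_ ?_)
    · refine (loop_lie m n x y).trans ?_
      refine Eq.trans ?_ (congrArg₂ (· + ·) rfl (smul_zero _)).symm
      exact (add_zero _).symm
    · refine (congrArg₂ (· - ·) (congrArg₂ (· + ·) rfl (hz _ 0)) (hz _ 0)).trans ?_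
      change LoopAlgebra.residuePairing ℂ ℤ 𝔤 (-form θ) (AddMonoidAlgebra.single m 1 ⊗ₜ[ℂ] x)
        (AddMonoidAlgebra.single n 1 ⊗ₜ[ℂ] y) + 0 - 0 =
        0 + (if m + n = 0 then (m : ℂ) * form θ x y else 0) • (1 : ℂ)
      rw [residue_single]
      by_cases h : m + n = 0
      · have hm : m = -n := by omega
        subst hm
        simp
      · simp [h]
  refine SemiDirectSum.ext ?_ ?_
  · refine Eq.trans ?_ key
    refine (congrArg₂ (· - ·) (congrArg₂ (· + ·) rfl (h0 _)) (h0 _)).trans ?_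
    rw [add_zero, sub_zero]
  · change ⁅(0 : ℂ), (0 : ℂ)⁆ = 0 + _ • (0 : ℂ)
    simp

lemma lie_degreeElt_loopElt (θ : 𝔥.root) (n : ℤ) (x : 𝔤) :
    ⁅degreeElt θ, loopElt θ n x⁆ = (n : ℂ) • loopElt θ n x := by
  have h0 (a : AffineHat θ) : degreeAction θ 0 a = 0 := by rw [map_zero]; rfl
  have h1 : degreeAction θ 1 = hatDegree θ := one_smul ℂ _
  refine SemiDirectSum.ext ?_ ?_
  · change ⁅(0 : AffineHat θ), (loopElt θ n x).left⁆ + degreeAction θ 1 (loopElt θ n x).left -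
      degreeAction θ 0 0 = (n : ℂ) • (loopElt θ n x).left
    rw [zero_lie, h0, h1, zero_add, sub_zero]
    exact congrArg LieAlgebra.ofTwoCocycle.mk (Prod.ext (loopDegree_tmul n x) (smul_zero _).symm)
  · change ⁅(1 : ℂ), (0 : ℂ)⁆ = (n : ℂ) • (0 : ℂ)
    simp

lemma lie_centralElt (θ : 𝔥.root) (a : AffineKM θ) : ⁅centralElt θ, a⁆ = 0 := by
  have hz (f : loopAlgebra ℂ ℤ 𝔤) (z : TrivialLieModule ℂ (loopAlgebra ℂ ℤ 𝔤) ℂ) :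
    ⁅f, z⁆ = 0 := trivial_lie_zero ..
  have h0 (a : AffineHat θ) : degreeAction θ 0 a = 0 := by rw [map_zero]; rfl
  have h1 : degreeAction θ a.right (centralElt θ).left = 0 := by
    refine Eq.trans (b := a.right • hatDegree θ (centralElt θ).left) rfl ?_
    rw [show hatDegree θ (centralElt θ).left = 0 from
      congrArg LieAlgebra.ofTwoCocycle.mk (Prod.ext (map_zero (loopDegree 𝔤)) rfl), smul_zero]
  have h2 : ⁅(centralElt θ).left, a.left⁆ = 0 := by
    refine congrArg LieAlgebra.ofTwoCocycle.mk (Prod.ext ?_ ?_)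
    · exact zero_lie a.left.carrier.1
    · refine (congrArg₂ (· - ·) (congrArg₂ (· + ·) rfl (hz _ _)) (hz _ _)).trans ?_
      change LoopAlgebra.residuePairing ℂ ℤ 𝔤 (-form θ) 0 a.left.carrier.1 + 0 - 0 = (0 : ℂ)
      rw [map_zero, LinearMap.zero_apply, add_zero, sub_zero]
  refine SemiDirectSum.ext ?_ ?_
  · change ⁅(centralElt θ).left, a.left⁆ + degreeAction θ 0 a.left -
      degreeAction θ a.right (centralElt θ).left = 0
    rw [h0, h1, h2, add_zero, sub_zero]
  · exact zero_lie a.right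

/-- The Cartan subalgebra `𝔥 ⊕ ℂ k ⊕ ℂ d` of the affine Kac-Moody Lie algebra, as the image of
`(h, a, c) ↦ h ⊗ t^0 + a k + c d`. -/
def cartanIncl (θ : 𝔥.root) : 𝔥 × ℂ × ℂ →ₗ[ℂ] AffineKM θ :=
  LinearMap.coprod ({ toFun := fun h ↦ loopElt θ 0 h
                      map_add' := fun x y ↦ loopElt_add θ 0 x y
                      map_smul' := fun c x ↦ loopElt_smul θ 0 c x } : 𝔥 →ₗ[ℂ] AffineKM θ)
    (LinearMap.coprod (LinearMap.toSpanSingleton ℂ _ (centralElt θ))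
      (LinearMap.toSpanSingleton ℂ _ (degreeElt θ)))

/-- The functional `μ + ℓ k' + z d'` on `𝔥 ⊕ ℂ k ⊕ ℂ d`, where `k'`, `d'` are dual to `k`, `d`. -/
def affineWeight (μ : Dual ℂ 𝔥) (ℓ : ℕ) (z : ℂ) : Dual ℂ (𝔥 × ℂ × ℂ) :=
  μ ∘ₗ LinearMap.fst ℂ 𝔥 (ℂ × ℂ) +
    (ℓ : ℂ) • (LinearMap.fst ℂ ℂ ℂ ∘ₗ LinearMap.snd ℂ 𝔥 (ℂ × ℂ)) +
    z • (LinearMap.snd ℂ ℂ ℂ ∘ₗ LinearMap.snd ℂ 𝔥 (ℂ × ℂ))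

/-- The universal enveloping algebra; modules over the Lie algebra are modules over it. -/
abbrev AffineU (θ : 𝔥.root) : Type _ := UniversalEnvelopingAlgebra ℂ (AffineKM θ)

/-- The root vectors of the positive roots of the affine Kac-Moody Lie algebra (including the
imaginary ones): `x ⊗ 1` with `x` in a positive root space of `𝔤`, and `x ⊗ t^n` with `n > 0`. -/
def raisingSet (b : (rootSystem 𝔥).Base) (θ : 𝔥.root) : Set (AffineKM θ) :=
  {a | (∃ α : 𝔥.root, IsPositive b α ∧ ∃ x ∈ rootSpace 𝔥 α.1, a = loopElt θ 0 x) ∨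
    ∃ n : ℤ, 0 < n ∧ ∃ x : 𝔤, a = loopElt θ n x}

/-- The left ideal generated by the positive root vectors and by `h - Λ(h)` for `h` in the Cartan
subalgebra. -/
def vermaIdeal (b : (rootSystem 𝔥).Base) (θ : 𝔥.root) (Λ : Dual ℂ (𝔥 × ℂ × ℂ)) :
    Submodule (AffineU θ) (AffineU θ) :=
  Submodule.span (AffineU θ)
    (UniversalEnvelopingAlgebra.ι ℂ '' raisingSet b θ ∪
      Set.range fun h : 𝔥 × ℂ × ℂ ↦
        UniversalEnvelopingAlgebra.ι ℂ (cartanIncl θ h) - algebraMap ℂ (AffineU θ) (Λ h))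

/-- The Verma module `M(Λ)`; the class of `1` is its highest weight vector. -/
abbrev VermaModule (b : (rootSystem 𝔥).Base) (θ : 𝔥.root) (Λ : Dual ℂ (𝔥 × ℂ × ℂ)) : Type _ :=
  AffineU θ ⧸ vermaIdeal b θ Λ

/-- The irreducible highest weight module `L(Λ)`: the quotient of the Verma module by its largest
proper submodule, the sum of all proper submodules. It is the standard module with highest weight
`Λ` when `Λ` is dominant integral. -/
abbrev StandardModule (b : (rootSystem 𝔥).Base) (θ : 𝔥.root) (Λ : Dual ℂ (𝔥 × ℂ × ℂ)) : Type _ :=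
  VermaModule b θ Λ ⧸ sSup {N : Submodule (AffineU θ) (VermaModule b θ Λ) | N ≠ ⊤}

/-- `Λ` is a weight of the module `M`: some non-zero `v` satisfies `h v = Λ(h) v` for all `h` in the
Cartan subalgebra. -/
def IsWeightOf (θ : 𝔥.root) (M : Type*) [AddCommGroup M] [Module (AffineU θ) M]
    (Λ : Dual ℂ (𝔥 × ℂ × ℂ)) : Prop :=
  ∃ v : M, v ≠ 0 ∧ ∀ h : 𝔥 × ℂ × ℂ,
    UniversalEnvelopingAlgebra.ι ℂ (cartanIncl θ h) • v = algebraMap ℂ (AffineU θ) (Λ h) • v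

end Affine

end
end AffineLie

/-! Let `δ` be the affine imaginary root, let `α₀ = δ - θ`, and write `(·,·)` for the invariant form
on the affine weights. Set `ρ̂ = ρ + h^∨ k'`. A weight of `L(Λ)` has the form `Λ' = Λ - d` with `d`
a sum of affine simple roots, and two inequalities force `d = 0`.

Norm inequality: `(Λ, Λ) - (Λ', Λ') = 2(Λ, d) - (d, d) ≥ 0` (`norm_le`). If `Λ'` is dominant, this
number is `(Λ, d) + (Λ', d)`, a sum of non-negative terms. Otherwise a simple reflection, which
preserves the norm, gives a weight closer to `Λ`, and induction on the height of `d` applies. The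
reflected weight occurs in `L(Λ)` because each `f_i` acts locally nilpotently: `f_i ^ (N + 1)` sends
the highest weight vector to a singular vector, which vanishes by irreducibility.

Positivity: `(d, ρ̂) > 0` for `d ≠ 0` (`rho_pair_pos`). At `α₀` this is the identity `h^∨ = ρ(θ^∨) +
1` (`dualCoxeter_eq`).

Together, `(Λ + ρ̂, Λ + ρ̂) > (Λ' + ρ̂, Λ' + ρ̂)` unless `d = 0`. The conformal weights are chosen
so that, after subtracting `(ρ, ρ)`, the left side is `0` and the right side is `2(ℓ + h^∨) m ≥ 0`,
a contradiction (`weight_eq`). -/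

namespace AffineLie

open scoped TensorProduct
open Module LieModule LieAlgebra LieAlgebra.IsKilling

noncomputable section

/-! ### Finite root system: highest root, `ρ` and the dual Coxeter number. -/

section FiniteRoots

variable {𝔤 : Type*} [LieRing 𝔤] [LieAlgebra ℂ 𝔤] [FiniteDimensional ℂ 𝔤]
  [LieAlgebra.IsSimple ℂ 𝔤] {𝔥 : LieSubalgebra ℂ 𝔤} [𝔥.IsCartanSubalgebra]

/-- The linear functional on `𝔥*` taking the value `1` on every simple root. -/
def heightFun (b : (rootSystem 𝔥).Base) : Dual ℂ 𝔥 →ₗ[ℂ] ℂ :=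
  b.toWeightBasis.constr ℂ fun _ ↦ 1

lemma heightFun_simple (b : (rootSystem 𝔥).Base) {i : 𝔥.root} (hi : i ∈ b.support) :
    heightFun b i.1.toLinear = 1 := by
  have := b.toWeightBasis.constr_basis ℂ (fun _ ↦ (1 : ℂ)) ⟨i, hi⟩
  rwa [RootPairing.Base.toWeightBasis_apply] at this

lemma simple_mem_Qplus (b : (rootSystem 𝔥).Base) {i : 𝔥.root} (hi : i ∈ b.support) :
    i.1.toLinear ∈ Qplus b :=
  AddSubmonoid.subset_closure ⟨i, hi, rfl⟩

/-- Heights live in `ℂ`; this makes them natural numbers on `Q₊` that detect zero, whence `Q₊ ∩ -Q₊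
= 0`. -/
lemma heightFun_Qplus (b : (rootSystem 𝔥).Base) {x : Dual ℂ 𝔥} (hx : x ∈ Qplus b) :
    ∃ n : ℕ, heightFun b x = n ∧ (n = 0 → x = 0) := by
  induction hx using AddSubmonoid.closure_induction with
  | mem x hx =>
    obtain ⟨i, hi, rfl⟩ := hx
    exact ⟨1, by simpa using heightFun_simple b hi, by simp⟩
  | zero => exact ⟨0, by simp⟩
  | add x y _ _ hx hy =>
    obtain ⟨n, hn, hn0⟩ := hx
    obtain ⟨m, hm, hm0⟩ := hy
    refine ⟨n + m, by simp [hn, hm], fun h ↦ ?_⟩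
    rw [hn0 (by omega), hm0 (by omega), add_zero]

lemma eq_zero_of_Qplus_neg (b : (rootSystem 𝔥).Base) {x : Dual ℂ 𝔥} (hx : x ∈ Qplus b)
    (hx' : -x ∈ Qplus b) : x = 0 := by
  obtain ⟨n, hn, hn0⟩ := heightFun_Qplus b hx
  obtain ⟨m, hm, -⟩ := heightFun_Qplus b hx'
  rw [map_neg, hn] at hm
  have : (n : ℤ) + m = 0 := by
    have : ((n + m : ℕ) : ℂ) = 0 := by push_cast; rw [← hm]; ring
    exact_mod_cast this
  exact hn0 (by omega)

lemma root_toLinear_ne_zero (α : 𝔥.root) : α.1.toLinear ≠ 0 := fun h ↦ by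
  have h1 := root_apply_coroot (LieSubalgebra.isNonZero_coe_root α)
  have h2 : α.1 (coroot α.1) = 0 := LinearMap.congr_fun h (coroot α.1)
  rw [h1] at h2
  norm_num at h2

lemma root_mem_Qplus_or_neg (b : (rootSystem 𝔥).Base) (α : 𝔥.root) :
    α.1.toLinear ∈ Qplus b ∨ -α.1.toLinear ∈ Qplus b :=
  b.root_mem_or_neg_mem α

/-- The root `-α`. -/
def negRoot (α : 𝔥.root) : 𝔥.root :=
  ⟨-α.1, by simpa using (LieSubalgebra.isNonZero_coe_root α)⟩

lemma negRoot_toLinear (α : 𝔥.root) : (negRoot α).1.toLinear = -α.1.toLinear := rfl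

lemma exists_reflection (α β : 𝔥.root) : ∃ n : ℤ, α.1 (coroot β.1) = n ∧
    ∃ γ : 𝔥.root, γ.1.toLinear = α.1.toLinear - (n : ℂ) • β.1.toLinear := by
  obtain ⟨n, hn⟩ : ∃ n : ℤ, α.1 (coroot β.1) = n := ⟨_, apply_coroot_eq_cast β.1 α.1⟩
  refine ⟨n, hn, (rootSystem 𝔥).reflectionPerm β α, ?_⟩
  have := (rootSystem 𝔥).root_reflectionPerm β α
  rw [rootSystem_root_apply, RootPairing.reflection_apply_root] at this
  rw [this, rootSystem_pairing_apply, hn]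
  rfl

lemma highest_sub_mem {b : (rootSystem 𝔥).Base} {θ : 𝔥.root} (hθ : IsHighestRoot b θ)
    (α : 𝔥.root) : θ.1.toLinear - α.1.toLinear ∈ Qplus b := hθ α

lemma highest_add_mem {b : (rootSystem 𝔥).Base} {θ : 𝔥.root} (hθ : IsHighestRoot b θ)
    (α : 𝔥.root) : θ.1.toLinear + α.1.toLinear ∈ Qplus b := by
  have := hθ (negRoot α)
  rwa [negRoot_toLinear, sub_neg_eq_add] at this

/-- Since `-θ` is also a root, `2θ = θ - (-θ)` lies in `Q₊`. If `-θ` did too, so would their sum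
`θ`, and `θ` would vanish. -/
lemma highest_mem_Qplus {b : (rootSystem 𝔥).Base} {θ : 𝔥.root} (hθ : IsHighestRoot b θ) :
    θ.1.toLinear ∈ Qplus b := by
  refine (root_mem_Qplus_or_neg b θ).resolve_right fun h ↦ root_toLinear_ne_zero θ ?_
  have h2 : θ.1.toLinear ∈ Qplus b := by
    have := add_mem (highest_add_mem hθ θ) h
    rwa [add_neg_cancel_right] at this
  exact eq_zero_of_Qplus_neg b h2 h

lemma not_neg_highest_mem {b : (rootSystem 𝔥).Base} {θ : 𝔥.root} (hθ : IsHighestRoot b θ) :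
    -θ.1.toLinear ∉ Qplus b := fun h ↦
  root_toLinear_ne_zero θ (eq_zero_of_Qplus_neg b (highest_mem_Qplus hθ) h)

/-- A positive root other than `θ` pairs to `0` or `1` with the coroot of the highest root `θ`. -/
lemma positive_apply_coroot_highest {b : (rootSystem 𝔥).Base} {θ : 𝔥.root}
    (hθ : IsHighestRoot b θ) {α : 𝔥.root} (hα : IsPositive b α) (hne : α ≠ θ) :
    α.1 (coroot θ.1) = 0 ∨ α.1 (coroot θ.1) = 1 := by
  obtain ⟨n, hn, γ, hγ⟩ := exists_reflection α θ
  have hθ0 := highest_mem_Qplus hθ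
  have hne' : θ.1.toLinear - α.1.toLinear ≠ 0 := fun h ↦ hne (by
    ext x
    exact (LinearMap.congr_fun (sub_eq_zero.1 h) x).symm)
  -- The reflected root `γ = α - nθ` must lie between `-θ` and `θ`. A value `n ≤ -1` would push it
  -- above `θ`, and a value `n ≥ 2` below `-θ`.
  have key1 : 0 ≤ n := by
    by_contra! hlt
    obtain ⟨k, hk⟩ : ∃ k : ℕ, n = -1 - k := ⟨(-1 - n).toNat, by omega⟩
    have h1 := add_mem (highest_sub_mem hθ γ) (nsmul_mem hθ0 k)
    have h2 : θ.1.toLinear - γ.1.toLinear + k • θ.1.toLinear = -α.1.toLinear := by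
      rw [hγ, hk, ← Nat.cast_smul_eq_nsmul ℂ]; push_cast; module
    rw [h2] at h1
    exact root_toLinear_ne_zero α (eq_zero_of_Qplus_neg b hα h1)
  have key2 : n ≤ 1 := by
    by_contra! hlt
    obtain ⟨k, hk⟩ : ∃ k : ℕ, n = 2 + k := ⟨(n - 2).toNat, by omega⟩
    have h1 := add_mem (highest_add_mem hθ γ) (nsmul_mem hθ0 k)
    have h2 : θ.1.toLinear + γ.1.toLinear + k • θ.1.toLinear =
        -(θ.1.toLinear - α.1.toLinear) := by
      rw [hγ, hk, ← Nat.cast_smul_eq_nsmul ℂ]; push_cast; module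
    rw [h2] at h1
    exact hne' (eq_zero_of_Qplus_neg b (highest_sub_mem hθ α) h1)
  have : n = 0 ∨ n = 1 := by omega
  rcases this with rfl | rfl
  · left; simpa using hn
  · right; simpa using hn

lemma killing_coroot_eq_sum (α : 𝔥.root) : killingForm ℂ 𝔤 (coroot α.1 : 𝔤) (coroot α.1 : 𝔤) =
    ∑ β : 𝔥.root, β.1 (coroot α.1) * β.1 (coroot α.1) := by
  have h : (killingForm ℂ 𝔤).restrict 𝔥.toSubmodule (coroot α.1) (coroot α.1) = _ :=
    LinearMap.congr_fun₂ restrict_killingForm_eq_sum (coroot α.1) (coroot α.1)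
  refine Eq.trans h ?_
  simp only [LinearMap.sum_apply, LinearMap.smulRight_apply, LinearMap.smul_apply, smul_eq_mul]
  rw [← Finset.sum_coe_sort]
  rfl

-- In the order of `ComplexOrder`, `0 < z` says that `z` is real and positive, so positivity
-- statements here also carry reality. The value is a sum of squares of integers, one of them `2 ^
-- 2`.
open scoped ComplexOrder in
lemma killing_coroot_pos (α : 𝔥.root) :
    0 < killingForm ℂ 𝔤 (coroot α.1 : 𝔤) (coroot α.1 : 𝔤) := by
  rw [killing_coroot_eq_sum]
  refine Finset.sum_pos' (fun β _ ↦ ?_) ⟨α, Finset.mem_univ _, ?_⟩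
  · obtain ⟨n, hn, -⟩ := exists_reflection β α
    rw [hn]
    exact_mod_cast mul_self_nonneg n
  · rw [root_apply_coroot (LieSubalgebra.isNonZero_coe_root α)]
    norm_num

lemma root_apply_dual_symm (α : 𝔥.root) : α.1 ((cartanEquivDual 𝔥).symm α.1.toLinear) =
    4 / killingForm ℂ 𝔤 (coroot α.1 : 𝔤) (coroot α.1 : 𝔤) := by
  have hα : α.1.IsNonZero := LieSubalgebra.isNonZero_coe_root α
  have h := traceForm_coroot α.1 (coroot α.1)
  rw [root_apply_coroot hα] at h
  have h' : killingForm ℂ 𝔤 (coroot α.1 : 𝔤) (coroot α.1 : 𝔤) =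
    LieModule.traceForm ℂ 𝔥 𝔤 (coroot α.1) (coroot α.1) := rfl
  have h0 := root_apply_cartanEquivDual_symm_ne_zero hα
  rw [h', h]
  simp only [smul_eq_mul, nsmul_eq_mul, Nat.cast_ofNat]
  field_simp
  norm_num

open scoped ComplexOrder in
lemma dualForm_root_pos (θ α : 𝔥.root) : 0 < dualForm θ α.1.toLinear α.1.toLinear := by
  have h : dualForm θ α.1.toLinear α.1.toLinear =
      (formScale θ)⁻¹ * α.1 ((cartanEquivDual 𝔥).symm α.1.toLinear) := rfl
  rw [h, root_apply_dual_symm, formScale, inv_div]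
  exact mul_pos (div_pos (killing_coroot_pos θ) two_pos) (div_pos four_pos (killing_coroot_pos α))

/-- `⟨x, α⟩ = x(α^∨) ⟨α, α⟩ / 2`. -/
lemma dualForm_root_right (θ α : 𝔥.root) (x : Dual ℂ 𝔥) : dualForm θ x α.1.toLinear =
    x (coroot α.1) * (dualForm θ α.1.toLinear α.1.toLinear / 2) := by
  have hi := root_apply_cartanEquivDual_symm_ne_zero (LieSubalgebra.isNonZero_coe_root α)
  have hs := formScale_ne_zero θ
  simp [dualForm, coroot]
  field_simp

lemma dualForm_highest_right (θ : 𝔥.root) (x : Dual ℂ 𝔥) :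
    dualForm θ x θ.1.toLinear = x (coroot θ.1) := by
  rw [dualForm_root_right, dualForm_self]; ring

lemma dualForm_comm (θ : 𝔥.root) (x y : Dual ℂ 𝔥) : dualForm θ x y = dualForm θ y x := by
  have h (z w : Dual ℂ 𝔥) : dualForm θ z w = (formScale θ)⁻¹ *
      LieModule.traceForm ℂ 𝔥 𝔤 ((cartanEquivDual 𝔥).symm z) ((cartanEquivDual 𝔥).symm w) := by
    have h1 : cartanEquivDual 𝔥 ((cartanEquivDual 𝔥).symm z) ((cartanEquivDual 𝔥).symm w) =
        z ((cartanEquivDual 𝔥).symm w) := by rw [LinearEquiv.apply_symm_apply]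
    exact congrArg ((formScale θ)⁻¹ * ·) h1.symm
  rw [h, h, LieModule.traceForm_comm]

lemma isPositive_or_negRoot (b : (rootSystem 𝔥).Base) (α : 𝔥.root) :
    IsPositive b α ∨ IsPositive b (negRoot α) := root_mem_Qplus_or_neg b α

lemma not_isPositive_iff (b : (rootSystem 𝔥).Base) (α : 𝔥.root) :
    ¬ IsPositive b α ↔ IsPositive b (negRoot α) := by
  refine ⟨(isPositive_or_negRoot b α).resolve_left, fun h h' ↦ ?_⟩
  exact root_toLinear_ne_zero α (eq_zero_of_Qplus_neg b h' h)

lemma heightFun_root (b : (rootSystem 𝔥).Base) (α : 𝔥.root) :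
    heightFun b α.1.toLinear = b.height α := by
  obtain ⟨f, -, -, hf⟩ := b.exists_root_eq_sum_int α
  rw [RootPairing.Base.height_eq_sum hf]
  rw [rootSystem_root_apply] at hf
  rw [hf, map_sum, Int.cast_sum]
  refine Finset.sum_congr rfl fun j hj ↦ ?_
  rw [map_zsmul, rootSystem_root_apply, heightFun_simple b hj]
  simp

/-- Both notions are read off from the sign of the height. The bridge gives access to the fact that
a simple reflection permutes the positive roots other than its own. -/
lemma isPositive_iff (b : (rootSystem 𝔥).Base) (α : 𝔥.root) : IsPositive b α ↔ b.IsPos α := by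
  have key (β : 𝔥.root) (h : IsPositive b β) : b.IsPos β := by
    obtain ⟨n, hn, hn0⟩ := heightFun_Qplus b h
    rw [heightFun_root] at hn
    have hn' : b.height β = n := by exact_mod_cast hn
    have : n ≠ 0 := fun h ↦ root_toLinear_ne_zero β (hn0 h)
    rw [RootPairing.Base.isPos_iff]
    omega
  refine ⟨key α, fun h ↦ ?_⟩
  by_contra hc
  have h1 := key _ ((not_isPositive_iff b α).1 hc)
  rw [RootPairing.Base.isPos_iff] at h1 h
  have h2 := heightFun_root b (negRoot α)
  rw [negRoot_toLinear, map_neg, heightFun_root] at h2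
  have : -b.height α = b.height (negRoot α) := by exact_mod_cast h2
  omega

/-- The half sum of the positive roots pairs to `1` with every simple coroot. -/
lemma rho_simple_coroot (b : (rootSystem 𝔥).Base) {i : 𝔥.root} (hi : i ∈ b.support) :
    rho b (coroot i.1) = 1 := by
  classical
  have hipos : IsPositive b i := simple_mem_Qplus b hi
  -- The root `α_i` itself contributes `2`. The reflection `s_i` permutes the other positive roots
  -- and negates their values on `α_i^∨`, so these cancel in pairs.
  have hsum : ∑ α : 𝔥.root with IsPositive b α, α.1 (coroot i.1) = 2 := by
    rw [← Finset.add_sum_erase _ _ (Finset.mem_filter.2 ⟨Finset.mem_univ i, hipos⟩),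
      root_apply_coroot (LieSubalgebra.isNonZero_coe_root i), add_eq_left]
    have hrefl (α : 𝔥.root) : ((rootSystem 𝔥).reflectionPerm i α).1 (coroot i.1) =
        -α.1 (coroot i.1) := by
      have := (rootSystem 𝔥).pairing_reflectionPerm i α i
      rw [RootPairing.pairing_reflectionPerm_self_right] at this
      simpa only [rootSystem_pairing_apply] using this.symm
    refine Finset.sum_involution (fun α _ ↦ (rootSystem 𝔥).reflectionPerm i α) ?_ ?_ ?_ ?_
    · intro α _
      rw [hrefl, add_neg_cancel]
    · intro α _ h0 h1
      have := hrefl α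
      rw [h1] at this
      exact h0 (self_eq_neg.1 this)
    · intro α hα
      simp only [Finset.mem_erase, Finset.mem_filter, Finset.mem_univ, true_and] at hα ⊢
      refine ⟨fun h ↦ ?_, ?_⟩
      · have h1 : α = (rootSystem 𝔥).reflectionPerm i i := by
          have := congrArg ((rootSystem 𝔥).reflectionPerm i) h
          rwa [RootPairing.reflectionPerm_self] at this
        have h2 := (rootSystem 𝔥).root_reflectionPerm i i
        rw [← h1, RootPairing.reflection_apply_self] at h2
        have h3 : α.1.toLinear = -i.1.toLinear := h2
        exact root_toLinear_ne_zero i (eq_zero_of_Qplus_neg b hipos (h3 ▸ hα.2))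
      · rw [isPositive_iff]
        exact ((isPositive_iff b α).1 hα.2).reflectionPerm hi hα.1
    · intro α _
      simp
  rw [rho, LinearMap.smul_apply, LinearMap.sum_apply]
  simp only [Weight.toLinear_apply, smul_eq_mul]
  rw [hsum]; norm_num

lemma dualCoxeter_eq_scale (θ : 𝔥.root) : dualCoxeter θ = (formScale θ)⁻¹ / 2 := by
  have h1 := casimirAd_eq_scale θ (coroot θ.1 : 𝔤)
  rw [casimirAd_apply] at h1
  have h0 : (coroot θ.1 : 𝔤) ≠ 0 := by simp
  have := smul_left_injective ℂ h0 h1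
  rw [← this]; ring

/-- By `dualCoxeter_eq_scale`, `4 h^∨` is the Killing norm of `θ^∨`, that is, twice the sum of
`β(θ^∨)²` over positive roots `β`. For `β ≠ θ` the value is `0` or `1` and equals its square; for `β
= θ` the square exceeds the value by `4 - 2 = 2`. So the sum is `2ρ(θ^∨) + 2`. -/
lemma dualCoxeter_eq {b : (rootSystem 𝔥).Base} {θ : 𝔥.root} (hθ : IsHighestRoot b θ) :
    dualCoxeter θ = rho b (coroot θ.1) + 1 := by
  classical
  have hsq : ∑ β : 𝔥.root, β.1 (coroot θ.1) * β.1 (coroot θ.1) =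
      2 * ∑ β : 𝔥.root with IsPositive b β, β.1 (coroot θ.1) * β.1 (coroot θ.1) := by
    rw [← Finset.sum_filter_add_sum_filter_not _ (IsPositive b), two_mul, add_right_inj]
    refine Finset.sum_bij' (fun β _ ↦ negRoot β) (fun β _ ↦ negRoot β) ?_ ?_ ?_ ?_ ?_
    · intro β hβ
      simpa [not_isPositive_iff] using hβ
    · intro β hβ
      simpa [not_isPositive_iff, negRoot] using hβ
    · intro β _; simp [negRoot]
    · intro β _; simp [negRoot]
    · intro β _; simp [negRoot]
  have hlin : ∑ β : 𝔥.root with IsPositive b β, β.1 (coroot θ.1) * β.1 (coroot θ.1) =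
      ∑ β : 𝔥.root with IsPositive b β, β.1 (coroot θ.1) + 2 := by
    have hmem : θ ∈ Finset.univ.filter (IsPositive b) :=
      Finset.mem_filter.2 ⟨Finset.mem_univ θ, highest_mem_Qplus hθ⟩
    rw [← Finset.add_sum_erase _ _ hmem, ← Finset.add_sum_erase _ (fun β ↦ β.1 (coroot θ.1)) hmem]
    have : ∑ β ∈ (Finset.univ.filter (IsPositive b)).erase θ,
        β.1 (coroot θ.1) * β.1 (coroot θ.1) =
        ∑ β ∈ (Finset.univ.filter (IsPositive b)).erase θ, β.1 (coroot θ.1) := by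
      refine Finset.sum_congr rfl fun β hβ ↦ ?_
      simp only [Finset.mem_erase, Finset.mem_filter, Finset.mem_univ, true_and] at hβ
      rcases positive_apply_coroot_highest hθ hβ.2 hβ.1 with h | h <;> rw [h] <;> norm_num
    change _ + ∑ β ∈ (Finset.univ.filter (IsPositive b)).erase θ, _ =
      _ + ∑ β ∈ (Finset.univ.filter (IsPositive b)).erase θ, _ + 2
    rw [this, root_apply_coroot (LieSubalgebra.isNonZero_coe_root θ)]
    ring
  rw [dualCoxeter_eq_scale, formScale, inv_div, killing_coroot_eq_sum, hsq, hlin, rho,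
    LinearMap.smul_apply, LinearMap.sum_apply]
  simp only [Weight.toLinear_apply, smul_eq_mul]
  ring

end FiniteRoots
end
end AffineLie

namespace AffineLie

open Module LieModule

/-! ### `sl₂`-triples and locally nilpotent vectors in arbitrary modules. -/

section LieModules

variable {L M : Type*} [LieRing L] [LieAlgebra ℂ L] [AddCommGroup M] [Module ℂ M]
  [LieRingModule L M] [LieModule ℂ L M]

lemma lie_h_pow_f {h e f : L} (t : IsSl2Triple h e f) {v : M} {c : ℂ} (hv : ⁅h, v⁆ = c • v)
    (n : ℕ) : ⁅h, (toEnd ℂ L M f ^ n) v⁆ = (c - 2 * n) • (toEnd ℂ L M f ^ n) v := by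
  induction n with
  | zero => simpa using hv
  | succ n ih =>
    rw [pow_succ', Module.End.mul_apply, toEnd_apply_apply, leibniz_lie, ih,
      t.lie_lie_smul_f ℂ, neg_lie, smul_lie, lie_smul]
    push_cast
    module

lemma lie_e_pow_succ_f {h e f : L} (t : IsSl2Triple h e f) {v : M} {c : ℂ}
    (hv : ⁅h, v⁆ = c • v) (n : ℕ) : ⁅e, (toEnd ℂ L M f ^ (n + 1)) v⁆ =
      (toEnd ℂ L M f ^ (n + 1)) ⁅e, v⁆ + ((n + 1) * (c - n) : ℂ) • (toEnd ℂ L M f ^ n) v := by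
  induction n with
  | zero =>
    simp only [zero_add, pow_one, toEnd_apply_apply, pow_zero, Module.End.one_apply]
    rw [leibniz_lie, t.lie_e_f, hv]
    push_cast
    module
  | succ n ih =>
    rw [pow_succ', Module.End.mul_apply, Module.End.mul_apply, toEnd_apply_apply,
      toEnd_apply_apply, leibniz_lie, ih, t.lie_e_f, lie_h_pow_f t hv, lie_add, lie_smul,
      pow_succ' _ n, Module.End.mul_apply, toEnd_apply_apply]
    push_cast
    module

/-- In a representation of `sl₂`, a vector of weight `c ≥ n` on which `e` acts nilpotently and which
is killed by `f ^ n` vanishes. -/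
lemma eq_zero_of_pow_e_of_pow_f {h e f : L} (t : IsSl2Triple h e f) {k : ℕ} :
    ∀ {v : M} {c n : ℕ}, ⁅h, v⁆ = (c : ℂ) • v → n ≤ c → (toEnd ℂ L M e ^ k) v = 0 →
      (toEnd ℂ L M f ^ n) v = 0 → v = 0 := by
  induction k with
  | zero => intro v c n _ _ h0 _; simpa using h0
  | succ k ih =>
    intro v c n hv hn hek hfn
    -- The vector `e v` has weight `c + 2` and needs one power of `e` fewer. It is killed by `f ^ (n
    -- + 1)` because `f ^ (n + 1) e v` and `e f ^ (n + 1) v` differ by a multiple of `f ^ n v = 0`.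
    have hev : ⁅e, v⁆ = 0 := by
      refine ih (c := c + 2) (n := n + 1) ?_ (by omega) ?_ ?_
      · rw [leibniz_lie, hv, t.lie_h_e_smul ℂ, smul_lie, lie_smul]
        push_cast
        module
      · rwa [pow_succ, Module.End.mul_apply, toEnd_apply_apply] at hek
      · have h1 := lie_e_pow_succ_f t hv n
        rw [hfn, smul_zero, add_zero] at h1
        rw [← h1, pow_succ', Module.End.mul_apply, hfn, map_zero, lie_zero]
    -- Now `e v = 0`, so `e f ^ (n + 1) v = (n + 1)(c - n) f ^ n v`. The coefficient is nonzero
    -- while `n < c`, and the power of `f` can be lowered to `0`.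
    induction n with
    | zero => simpa using hfn
    | succ n ihn =>
      refine ihn (by omega) ?_
      have h1 := lie_e_pow_succ_f t hv n
      rw [hfn, hev, lie_zero, map_zero, zero_add, eq_comm, smul_eq_zero] at h1
      refine h1.resolve_left (mul_ne_zero (by exact_mod_cast n.succ_ne_zero) ?_)
      rw [sub_ne_zero]
      exact_mod_cast (by omega : c ≠ n)

lemma mem_maxGenEigenspace_zero_iff (g : Module.End ℂ M) (v : M) :
    v ∈ g.maxGenEigenspace 0 ↔ ∃ k : ℕ, (g ^ k) v = 0 := by
  simp [Module.End.mem_maxGenEigenspace]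

/-- If `ad f` is locally nilpotent, then the vectors on which `f` acts nilpotently form a
Lie submodule. -/
def nilpotentVectors (f : L) (hf : ∀ y : L, ∃ k : ℕ, (toEnd ℂ L L f ^ k) y = 0) :
    LieSubmodule ℂ L M where
  __ := (toEnd ℂ L M f).maxGenEigenspace 0
  lie_mem {y m} hm := by
    have := lie_mem_maxGenEigenspace_toEnd (M := M)
      ((mem_maxGenEigenspace_zero_iff _ y).2 (hf y)) hm
    rwa [add_zero] at this

lemma mem_nilpotentVectors {f : L} (hf : ∀ y : L, ∃ k : ℕ, (toEnd ℂ L L f ^ k) y = 0) (v : M) :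
    v ∈ nilpotentVectors f hf ↔ ∃ k : ℕ, (toEnd ℂ L M f ^ k) v = 0 :=
  mem_maxGenEigenspace_zero_iff _ v

end LieModules
end AffineLie

namespace AffineLie

open scoped TensorProduct
open Module LieModule LieAlgebra LieAlgebra.IsKilling

noncomputable section

/-! ### Degrees, simple roots and simple `sl₂`-triples of the affine algebra. -/

section AffineRoots

attribute [local instance 100] LieRing.ofAssociativeRing

set_option linter.unusedSectionVars false

variable {𝔤 : Type*} [LieRing 𝔤] [LieAlgebra ℂ 𝔤] [FiniteDimensional ℂ 𝔤]
  [LieAlgebra.IsSimple ℂ 𝔤] {𝔥 : LieSubalgebra ℂ 𝔤} [𝔥.IsCartanSubalgebra]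

lemma eq_zero_or_exists_root {γ : Dual ℂ 𝔥} {x : 𝔤} (hx : x ∈ rootSpace 𝔥 γ) (hx0 : x ≠ 0) :
    γ = 0 ∨ ∃ α : 𝔥.root, α.1.toLinear = γ := by
  rcases eq_or_ne γ 0 with h | h
  · exact Or.inl h
  · right
    have hne : genWeightSpace 𝔤 (γ : 𝔥 → ℂ) ≠ ⊥ := fun h0 ↦ hx0 (by
      have hx' : x ∈ genWeightSpace 𝔤 (γ : 𝔥 → ℂ) := hx
      rwa [h0] at hx')
    let χ : Weight ℂ 𝔥 𝔤 := ⟨γ, hne⟩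
    have hχ : χ.IsNonZero := fun h0 ↦ h (by
      ext y
      exact congrFun h0 y)
    exact ⟨⟨χ, by simpa using hχ⟩, by ext y; rfl⟩

lemma lie_mem_rootSpace_add {γ δ : Dual ℂ 𝔥} {x y : 𝔤} (hx : x ∈ rootSpace 𝔥 γ)
    (hy : y ∈ rootSpace 𝔥 δ) : ⁅x, y⁆ ∈ rootSpace 𝔥 (γ + δ : Dual ℂ 𝔥) :=
  lie_mem_genWeightSpace_of_mem_genWeightSpace hx hy

lemma form_eq_zero_of_add_ne_zero (θ : 𝔥.root) {γ δ : Dual ℂ 𝔥} {x y : 𝔤}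
    (hx : x ∈ rootSpace 𝔥 γ) (hy : y ∈ rootSpace 𝔥 δ) (h : γ + δ ≠ 0) : form θ x y = 0 := by
  have h' : (γ : 𝔥 → ℂ) + δ ≠ 0 := fun h0 ↦ h (by ext z; exact congrFun h0 z)
  have := killingForm_apply_eq_zero_of_mem_rootSpace_of_add_ne_zero ℂ 𝔤 𝔥 hx hy h'
  simp [form, this]

lemma exists_of_rootSpace_zero {x : 𝔤} (hx : x ∈ rootSpace 𝔥 (0 : Dual ℂ 𝔥)) :
    ∃ y : 𝔥, (y : 𝔤) = x := by
  have hx' : x ∈ rootSpace 𝔥 (0 : 𝔥 → ℂ) := hx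
  rw [rootSpace_zero_eq] at hx'
  exact ⟨⟨x, hx'⟩, rfl⟩

lemma coe_mem_rootSpace_zero (x : 𝔥) : (x : 𝔤) ∈ rootSpace 𝔥 (0 : Dual ℂ 𝔥) := by
  have : (x : 𝔤) ∈ rootSpace 𝔥 (0 : 𝔥 → ℂ) := by
    rw [rootSpace_zero_eq]; exact x.2
  exact this

lemma rootSpace_induction {p : 𝔤 → Prop} (x : 𝔤)
    (mem : ∀ (γ : Dual ℂ 𝔥), ∀ x ∈ rootSpace 𝔥 γ, p x) (add : ∀ x y, p x → p y → p (x + y)) :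
    p x := by
  have hx : x ∈ ⨆ χ : Weight ℂ 𝔥 𝔤, (genWeightSpace 𝔤 χ).toSubmodule := by
    rw [LieSubmodule.iSup_toSubmodule_eq_top.2 (iSup_genWeightSpace_eq_top' ℂ 𝔥 𝔤)]
    trivial
  induction hx using Submodule.iSup_induction' with
  | mem χ x hx => exact mem χ.toLinear x hx
  | zero => exact mem 0 0 (zero_mem _)
  | add x y _ _ hx hy => exact add x y hx hy

lemma loopElt_zero (θ : 𝔥.root) (n : ℤ) : loopElt θ n (0 : 𝔤) = 0 := by
  have := loopElt_smul θ n 0 (0 : 𝔤)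
  rwa [zero_smul, zero_smul] at this

lemma loopElt_injective (θ : 𝔥.root) (n : ℤ) {x : 𝔤} (h : loopElt θ n x = 0) : x = 0 := by
  have h1 : (AddMonoidAlgebra.single n 1 ⊗ₜ[ℂ] x : loopAlgebra ℂ ℤ 𝔤) = 0 :=
    congrArg (fun a : AffineKM θ ↦ a.left.carrier.1) h
  have h2 := LoopAlgebra.toFinsupp_single_tmul ℂ ℤ 𝔤 n x
  rw [h1, map_zero] at h2
  exact (Finsupp.single_eq_zero.1 h2.symm)

/-- Linear induction on the affine algebra over homogeneous elements. -/
lemma affine_induction {θ : 𝔥.root} {p : AffineKM θ → Prop} (a : AffineKM θ)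
    (loop : ∀ (γ : Dual ℂ 𝔥) (n : ℤ), ∀ x ∈ rootSpace 𝔥 γ, p (loopElt θ n x))
    (central : p (centralElt θ)) (degree : p (degreeElt θ))
    (smul : ∀ (c : ℂ) a, p a → p (c • a)) (add : ∀ a b, p a → p b → p (a + b)) : p a := by
  have hloop (n : ℤ) (x : 𝔤) : p (loopElt θ n x) := by
    induction x using rootSpace_induction (𝔥 := 𝔥) with
    | mem γ x hx => exact loop γ n x hx
    | add x y hx hy => rw [loopElt_add]; exact add _ _ hx hy
  have hpure (f : loopAlgebra ℂ ℤ 𝔤) : p ⟨⟨(f, 0)⟩, 0⟩ := by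
    induction f using loop_induction with
    | single n x => exact hloop n x
    | add f g hf hg =>
      have : (⟨⟨(f + g, 0)⟩, 0⟩ : AffineKM θ) = ⟨⟨(f, 0)⟩, 0⟩ + ⟨⟨(g, 0)⟩, 0⟩ := by
        refine congrArg₂ SemiDirectSum.mk (congrArg LieAlgebra.ofTwoCocycle.mk (Prod.ext rfl ?_)) ?_
        · exact (add_zero 0).symm
        · exact (add_zero 0).symm
      rw [this]
      exact add _ _ hf hg
  obtain ⟨⟨f, c'⟩, z⟩ := a
  obtain ⟨c, rfl⟩ := (TrivialLieModule.equiv ℂ (loopAlgebra ℂ ℤ 𝔤) ℂ).symm.surjective c'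
  set E := (TrivialLieModule.equiv ℂ (loopAlgebra ℂ ℤ 𝔤) ℂ).symm
  have : (⟨⟨(f, E c)⟩, z⟩ : AffineKM θ) = ⟨⟨(f, 0)⟩, 0⟩ +
      (c • centralElt θ + z • degreeElt θ) := by
    refine congrArg₂ SemiDirectSum.mk (congrArg LieAlgebra.ofTwoCocycle.mk (Prod.ext ?_ ?_)) ?_
    · change f = f + (c • (0 : loopAlgebra ℂ ℤ 𝔤) + z • (0 : loopAlgebra ℂ ℤ 𝔤))
      rw [smul_zero, smul_zero, add_zero, add_zero]
    · change E c = E 0 + (c • E 1 + z • E 0)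
      rw [← map_smul, ← map_smul, ← map_add, ← map_add]
      simp
    · change z = 0 + (c • (0 : ℂ) + z • (1 : ℂ))
      simp
  rw [this]
  exact add _ _ (hpure f) (add _ _ (smul _ _ central) (smul _ _ degree))

lemma cartanIncl_apply (θ : 𝔥.root) (h : 𝔥 × ℂ × ℂ) : cartanIncl θ h =
    loopElt θ 0 (h.1 : 𝔤) + (h.2.1 • centralElt θ + h.2.2 • degreeElt θ) := rfl

lemma affineWeight_apply (μ : Dual ℂ 𝔥) (ℓ : ℕ) (z : ℂ) (h : 𝔥 × ℂ × ℂ) :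
    affineWeight μ ℓ z h = μ h.1 + ℓ * h.2.1 + z * h.2.2 := by
  simp [affineWeight]

/-- The functional on the affine Cartan subalgebra attached to the degree `(γ, n)`. -/
def degWeight : Dual ℂ 𝔥 × ℤ →+ Dual ℂ (𝔥 × ℂ × ℂ) where
  toFun d := affineWeight d.1 0 d.2
  map_zero' := by ext <;> simp [affineWeight_apply]
  map_add' d e := by ext <;> simp [affineWeight_apply]

lemma degWeight_apply (d : Dual ℂ 𝔥 × ℤ) (h : 𝔥 × ℂ × ℂ) :
    degWeight d h = d.1 h.1 + d.2 * h.2.2 := by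
  simp [degWeight, affineWeight_apply]

lemma degWeight_injective : Function.Injective (degWeight (𝔥 := 𝔥)) := by
  intro d e h
  refine Prod.ext (LinearMap.ext fun x ↦ ?_) ?_
  · have := LinearMap.congr_fun h (x, 0, 0)
    simpa [degWeight_apply] using this
  · have := LinearMap.congr_fun h (0, 0, 1)
    simpa [degWeight_apply] using this

lemma lie_cartanIncl_loopElt (θ : 𝔥.root) {γ : Dual ℂ 𝔥} (n : ℤ) {x : 𝔤}
    (hx : x ∈ rootSpace 𝔥 γ) (h : 𝔥 × ℂ × ℂ) :
    ⁅cartanIncl θ h, loopElt θ n x⁆ = degWeight (γ, n) h • loopElt θ n x := by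
  have h1 : ⁅(h.1 : 𝔤), x⁆ = γ h.1 • x := lie_eq_smul_of_mem_rootSpace hx h.1
  rw [cartanIncl_apply, add_lie, add_lie, smul_lie, smul_lie, lie_centralElt,
    lie_degreeElt_loopElt, lie_loopElt, h1, loopElt_smul, degWeight_apply]
  simp only [Int.cast_zero, zero_mul, ite_self, zero_smul, smul_zero, zero_add, add_zero]
  module

lemma lie_cartanIncl_centralElt (θ : 𝔥.root) (h : 𝔥 × ℂ × ℂ) :
    ⁅cartanIncl θ h, centralElt θ⁆ = 0 := by
  rw [← lie_skew, lie_centralElt, neg_zero]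

lemma lie_cartanIncl_degreeElt (θ : 𝔥.root) (h : 𝔥 × ℂ × ℂ) :
    ⁅cartanIncl θ h, degreeElt θ⁆ = 0 := by
  rw [cartanIncl_apply, add_lie, add_lie, smul_lie, smul_lie, lie_centralElt, lie_self,
    ← lie_skew, lie_degreeElt_loopElt]
  simp

lemma lie_cartanIncl_cartanIncl (θ : 𝔥.root) (h h' : 𝔥 × ℂ × ℂ) :
    ⁅cartanIncl θ h, cartanIncl θ h'⁆ = 0 := by
  rw [cartanIncl_apply θ h', lie_add, lie_add, lie_smul, lie_smul, lie_cartanIncl_centralElt,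
    lie_cartanIncl_degreeElt, lie_cartanIncl_loopElt θ 0 (coe_mem_rootSpace_zero h'.1),
    degWeight_apply]
  simp

/-- The degrees of the affine simple root vectors: `none` is the additional root `δ - θ`. -/
def simpleDeg (b : (rootSystem 𝔥).Base) (θ : 𝔥.root) : Option b.support → Dual ℂ 𝔥 × ℤ
  | none => (-θ.1.toLinear, 1)
  | some i => (i.1.1.toLinear, 0)

/-- The affine simple coroots. -/
def simpleCo (b : (rootSystem 𝔥).Base) (θ : 𝔥.root) : Option b.support → 𝔥 × ℂ × ℂ
  | none => (-coroot θ.1, 1, 0)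
  | some i => (coroot i.1.1, 0, 0)

/-- The monoid of non-negative integral combinations of the affine simple roots. -/
def affineQplus (b : (rootSystem 𝔥).Base) (θ : 𝔥.root) : AddSubmonoid (Dual ℂ 𝔥 × ℤ) :=
  AddSubmonoid.closure (Set.range (simpleDeg b θ))

lemma simpleDeg_mem (b : (rootSystem 𝔥).Base) (θ : 𝔥.root) (i : Option b.support) :
    simpleDeg b θ i ∈ affineQplus b θ := AddSubmonoid.subset_closure ⟨i, rfl⟩

/-- The additive functional on degrees with value `1` on every affine simple root. -/
def affineHeight (b : (rootSystem 𝔥).Base) (θ : 𝔥.root) : Dual ℂ 𝔥 × ℤ →+ ℂ where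
  -- Since `δ = α₀ + θ`, the height of `δ` has to be `1 + ht θ`.
  toFun d := heightFun b d.1 + (1 + heightFun b θ.1.toLinear) * d.2
  map_zero' := by simp
  map_add' d e := by simp; ring

lemma affineHeight_simpleDeg (b : (rootSystem 𝔥).Base) (θ : 𝔥.root) (i : Option b.support) :
    affineHeight b θ (simpleDeg b θ i) = 1 := by
  rcases i with _ | i
  · change heightFun b (-θ.1.toLinear) + (1 + heightFun b θ.1.toLinear) * ((1 : ℤ) : ℂ) = 1
    simp
  · change heightFun b i.1.1.toLinear + (1 + heightFun b θ.1.toLinear) * ((0 : ℤ) : ℂ) = 1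
    rw [heightFun_simple b i.2]
    simp

lemma affineHeight_affineQplus (b : (rootSystem 𝔥).Base) (θ : 𝔥.root) {d : Dual ℂ 𝔥 × ℤ}
    (hd : d ∈ affineQplus b θ) : ∃ n : ℕ, affineHeight b θ d = n ∧ (n = 0 → d = 0) := by
  induction hd using AddSubmonoid.closure_induction with
  | mem x hx =>
    obtain ⟨i, rfl⟩ := hx
    exact ⟨1, by simpa using affineHeight_simpleDeg b θ i, by simp⟩
  | zero => exact ⟨0, by simp⟩
  | add x y _ _ hx hy =>
    obtain ⟨n, hn, hn0⟩ := hx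
    obtain ⟨m, hm, hm0⟩ := hy
    refine ⟨n + m, by simp [hn, hm], fun h ↦ ?_⟩
    rw [hn0 (by omega), hm0 (by omega), add_zero]

lemma eq_zero_of_affineQplus_add (b : (rootSystem 𝔥).Base) (θ : 𝔥.root) {d e : Dual ℂ 𝔥 × ℤ}
    (hd : d ∈ affineQplus b θ) (he : e ∈ affineQplus b θ) (h : d + e = 0) : d = 0 := by
  obtain ⟨n, hn, hn0⟩ := affineHeight_affineQplus b θ hd
  obtain ⟨m, hm, -⟩ := affineHeight_affineQplus b θ he
  have h1 := map_add (affineHeight b θ) d e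
  rw [h, map_zero, hn, hm] at h1
  have : n + m = 0 := by exact_mod_cast h1.symm
  exact hn0 (by omega)

lemma Qplus_mem_affineQplus (b : (rootSystem 𝔥).Base) (θ : 𝔥.root) {γ : Dual ℂ 𝔥}
    (hγ : γ ∈ Qplus b) : (γ, (0 : ℤ)) ∈ affineQplus b θ := by
  induction hγ using AddSubmonoid.closure_induction with
  | mem x hx =>
    obtain ⟨i, hi, rfl⟩ := hx
    exact simpleDeg_mem b θ (some ⟨i, hi⟩)
  | zero => exact zero_mem _
  | add x y _ _ hx hy => simpa using add_mem hx hy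

/-- The degree of a positive affine root (or a degree not occurring in the affine algebra). -/
def IsPosDeg (b : (rootSystem 𝔥).Base) (d : Dual ℂ 𝔥 × ℤ) : Prop :=
  0 < d.2 ∨ d.2 = 0 ∧ d.1 ≠ 0 ∧ d.1 ∈ Qplus b

lemma highest_add_mem_of_rootSpace {b : (rootSystem 𝔥).Base} {θ : 𝔥.root}
    (hθ : IsHighestRoot b θ) {γ : Dual ℂ 𝔥} {x : 𝔤} (hx : x ∈ rootSpace 𝔥 γ) (hx0 : x ≠ 0) :
    γ + θ.1.toLinear ∈ Qplus b := by
  rcases eq_zero_or_exists_root hx hx0 with rfl | ⟨α, rfl⟩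
  · rw [zero_add]; exact highest_mem_Qplus hθ
  · rw [add_comm]; exact highest_add_mem hθ α

lemma highest_sub_mem_of_rootSpace {b : (rootSystem 𝔥).Base} {θ : 𝔥.root}
    (hθ : IsHighestRoot b θ) {γ : Dual ℂ 𝔥} {x : 𝔤} (hx : x ∈ rootSpace 𝔥 γ) (hx0 : x ≠ 0) :
    θ.1.toLinear - γ ∈ Qplus b := by
  rcases eq_zero_or_exists_root hx hx0 with rfl | ⟨α, rfl⟩
  · rw [sub_zero]; exact highest_mem_Qplus hθ
  · exact highest_sub_mem hθ α

/-- Write `γ + nδ = (γ + θ) + (n - 1)θ + n(δ - θ)`, with every summand in the monoid. -/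
lemma mem_affineQplus_of_pos {b : (rootSystem 𝔥).Base} {θ : 𝔥.root} (hθ : IsHighestRoot b θ)
    {γ : Dual ℂ 𝔥} {n : ℤ} (hn : 0 < n) (h : γ + θ.1.toLinear ∈ Qplus b) :
    (γ, n) ∈ affineQplus b θ := by
  obtain ⟨k, rfl⟩ : ∃ k : ℕ, n = k + 1 := ⟨(n - 1).toNat, by omega⟩
  have h1 := add_mem (Qplus_mem_affineQplus b θ (add_mem h (nsmul_mem (highest_mem_Qplus hθ) k)))
    (nsmul_mem (simpleDeg_mem b θ none) (k + 1))
  convert h1 using 1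
  refine Prod.ext ?_ ?_
  · simp only [simpleDeg, Prod.fst_add, Prod.smul_fst, ← Nat.cast_smul_eq_nsmul ℂ]
    push_cast
    module
  · simp [simpleDeg]

/-- Every degree occurring in the affine algebra is zero, positive, or minus a sum of simple
roots. -/
lemma degree_trichotomy {b : (rootSystem 𝔥).Base} {θ : 𝔥.root} (hθ : IsHighestRoot b θ)
    {γ : Dual ℂ 𝔥} (n : ℤ) {x : 𝔤} (hx : x ∈ rootSpace 𝔥 γ) (hx0 : x ≠ 0) :
    (γ = 0 ∧ n = 0) ∨ IsPosDeg b (γ, n) ∨ -(γ, n) ∈ affineQplus b θ := by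
  rcases lt_trichotomy n 0 with h | rfl | h
  · refine Or.inr (Or.inr (mem_affineQplus_of_pos hθ (by omega) ?_))
    rw [neg_add_eq_sub]
    exact highest_sub_mem_of_rootSpace hθ hx hx0
  · rcases eq_zero_or_exists_root hx hx0 with rfl | ⟨α, rfl⟩
    · exact Or.inl ⟨rfl, rfl⟩
    · right
      rcases root_mem_Qplus_or_neg b α with h | h
      · exact Or.inl (Or.inr ⟨rfl, root_toLinear_ne_zero α, h⟩)
      · right
        simpa using Qplus_mem_affineQplus b θ h
  · exact Or.inr (Or.inl (Or.inl h))

lemma degWeight_simpleCo_int (b : (rootSystem 𝔥).Base) (θ : 𝔥.root) {d : Dual ℂ 𝔥 × ℤ}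
    (hd : d ∈ affineQplus b θ) (i : Option b.support) :
    ∃ z : ℤ, degWeight d (simpleCo b θ i) = z := by
  induction hd using AddSubmonoid.closure_induction with
  | mem x hx =>
    obtain ⟨j, rfl⟩ := hx
    have key (α β : 𝔥.root) : ∃ z : ℤ, (α.1.toLinear : Dual ℂ 𝔥) (coroot β.1) = z := by
      obtain ⟨n, hn, -⟩ := exists_reflection α β
      exact ⟨n, hn⟩
    rcases i with _ | i <;> rcases j with _ | j <;>
      simp only [simpleDeg, simpleCo, degWeight_apply, map_neg, LinearMap.neg_apply, neg_neg,
        mul_zero, add_zero]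
    · exact key _ _
    · obtain ⟨z, hz⟩ := key j θ
      exact ⟨-z, by rw [hz]; simp⟩
    · obtain ⟨z, hz⟩ := key θ i
      exact ⟨-z, by rw [hz]; simp⟩
    · exact key _ _
  | zero => exact ⟨0, by simp⟩
  | add x y _ _ hx hy =>
    obtain ⟨n, hn⟩ := hx
    obtain ⟨m, hm⟩ := hy
    exact ⟨n + m, by simp [hn, hm]⟩

lemma rootSpace_two_smul_root (α : 𝔥.root) {x : 𝔤}
    (hx : x ∈ rootSpace 𝔥 (α.1.toLinear + α.1.toLinear : Dual ℂ 𝔥)) : x = 0 := by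
  have h := rootSpace_two_smul α.1 (LieSubalgebra.isNonZero_coe_root α)
  have h2 : (2 • (α.1 : 𝔥 → ℂ)) = ((α.1.toLinear + α.1.toLinear : Dual ℂ 𝔥) : 𝔥 → ℂ) := by
    rw [two_nsmul]; rfl
  rw [h2] at h
  rw [h] at hx
  exact hx

/-- The simple root vectors and coroots of the affine algebra form `sl₂`-triples. -/
lemma exists_simple_sl2 (b : (rootSystem 𝔥).Base) (θ : 𝔥.root) (i : Option b.support) :
    ∃ x ∈ rootSpace 𝔥 (simpleDeg b θ i).1, ∃ y ∈ rootSpace 𝔥 (-(simpleDeg b θ i).1 : Dual ℂ 𝔥),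
      IsSl2Triple (cartanIncl θ (simpleCo b θ i)) (loopElt θ (simpleDeg b θ i).2 x)
        (loopElt θ (-(simpleDeg b θ i).2) y) := by
  have mk {d : Dual ℂ 𝔥 × ℤ} {h : 𝔥 × ℂ × ℂ} {x y : 𝔤} (hx : x ∈ rootSpace 𝔥 d.1)
      (hy : y ∈ rootSpace 𝔥 (-d.1 : Dual ℂ 𝔥)) (hd : degWeight d h = 2) (hx0 : x ≠ 0)
      (hxy : ⁅loopElt θ d.2 x, loopElt θ (-d.2) y⁆ = cartanIncl θ h) :
      IsSl2Triple (cartanIncl θ h) (loopElt θ d.2 x) (loopElt θ (-d.2) y) := by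
    have h1 := lie_cartanIncl_loopElt θ d.2 hx h
    have h2 := lie_cartanIncl_loopElt θ (-d.2) hy h
    have h3 : degWeight (-d.1, -d.2) h = -2 := by
      rw [← hd, ← LinearMap.neg_apply, ← map_neg]; rfl
    rw [show (d.1, d.2) = d from rfl, hd] at h1
    rw [h3] at h2
    refine ⟨fun h0 ↦ ?_, hxy, ?_, ?_⟩
    · rw [h0, zero_lie] at h1
      exact hx0 (loopElt_injective θ _ ((smul_eq_zero.1 h1.symm).resolve_left two_ne_zero))
    · rw [h1, two_smul, two_nsmul]
    · rw [h2, neg_smul, two_smul, two_nsmul]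
  rcases i with _ | i
  · have hθ := LieSubalgebra.isNonZero_coe_root θ
    obtain ⟨h, e, f, t, he, hf⟩ := exists_isSl2Triple_of_weight_isNonZero hθ
    have hco := t.h_eq_coroot hθ he hf
    -- For the triple `(f ⊗ t, e ⊗ t⁻¹)` the bracket is `-θ^∨ + ⟨f, e⟩ k`. The normalisation `⟨θ^∨,
    -- θ^∨⟩ = 2` and invariance make the coefficient of `k` equal to `1`.
    have hform : form θ f e = 1 := by
      have h1 : form θ (coroot θ.1 : 𝔤) (coroot θ.1 : 𝔤) = 2 :=
        div_mul_cancel₀ 2 (killingForm_coroot_ne_zero θ)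
      have h2 := form_lieInvariant θ e f h
      rw [t.lie_e_f, ← lie_skew, t.lie_h_e_smul ℂ, map_neg, neg_neg, map_smul, hco, h1,
        smul_eq_mul] at h2
      exact mul_left_cancel₀ two_ne_zero (h2.symm.trans (mul_one 2).symm)
    refine ⟨f, hf, e, ?_, mk hf ?_ ?_ t.f_ne_zero ?_⟩
    · simpa [simpleDeg] using he
    · simpa [simpleDeg] using he
    · simp [simpleDeg, simpleCo, degWeight_apply, root_apply_coroot hθ]
    · simp only [simpleDeg, simpleCo]
      rw [lie_loopElt, cartanIncl_apply, ← lie_skew, t.lie_e_f, hco, hform]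
      simp
  · have hα := LieSubalgebra.isNonZero_coe_root i.1
    obtain ⟨h, e, f, t, he, hf⟩ := exists_isSl2Triple_of_weight_isNonZero hα
    have hco := t.h_eq_coroot hα he hf
    refine ⟨e, he, f, hf, mk he hf ?_ t.e_ne_zero ?_⟩
    · simp [simpleDeg, simpleCo, degWeight_apply, root_apply_coroot hα]
    · simp only [simpleDeg, simpleCo]
      rw [lie_loopElt, cartanIncl_apply, t.lie_e_f, hco]
      simp

/-- Bracketing with a negative simple root vector preserves the positive root vectors of degree
different from that simple root. -/
lemma lie_simple_posDeg {b : (rootSystem 𝔥).Base} {θ : 𝔥.root} (hθ : IsHighestRoot b θ)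
    (i : Option b.support) {y : 𝔤} (hy : y ∈ rootSpace 𝔥 (-(simpleDeg b θ i).1 : Dual ℂ 𝔥))
    {γ : Dual ℂ 𝔥} {n : ℤ} {x : 𝔤} (hx : x ∈ rootSpace 𝔥 γ) (hpos : IsPosDeg b (γ, n))
    (hne : (γ, n) ≠ simpleDeg b θ i) :
    ⁅loopElt θ n x, loopElt θ (-(simpleDeg b θ i).2) y⁆ = 0 ∨
      ⁅loopElt θ n x, loopElt θ (-(simpleDeg b θ i).2) y⁆ =
        loopElt θ (n - (simpleDeg b θ i).2) ⁅x, y⁆ ∧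
      IsPosDeg b ((γ, n) - simpleDeg b θ i) ∧ (γ, n) - simpleDeg b θ i ≠ simpleDeg b θ i := by
  have hm := lie_mem_rootSpace_add hx hy
  rcases eq_or_ne x 0 with rfl | hx0
  · left
    rw [loopElt_zero, zero_lie]
  rcases i with _ | i
  · have hadd := highest_add_mem_of_rootSpace hθ hx hx0
    simp only [simpleDeg, neg_neg] at hm hy hne ⊢
    have hbr := lie_loopElt θ n (-1) x y
    rcases eq_or_ne (γ + θ.1.toLinear) 0 with hγ | hγ
    · have hγ' : γ = -θ.1.toLinear := eq_neg_of_add_eq_zero_left hγ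
      -- The degree `δ - θ` is excluded, so the bracket has degree `(n - 1)δ` with `n - 1 > 0`: a
      -- positive imaginary root, without central term.
      have hn : 1 < n := by
        rcases hpos with hn | ⟨-, -, hQ⟩
        · have : n ≠ 1 := fun h1 ↦ hne (by rw [hγ', h1])
          change 0 < n at hn
          omega
        · rw [hγ'] at hQ
          exact absurd hQ (not_neg_highest_mem hθ)
      right
      rw [hbr, if_neg (by omega), zero_smul, add_zero]
      refine ⟨rfl, Or.inl ?_, fun h1 ↦ ?_⟩
      · change 0 < n - 1
        omega
      · have h2 : γ - -θ.1.toLinear = -θ.1.toLinear := congrArg Prod.fst h1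
        rw [sub_neg_eq_add, hγ, eq_comm, neg_eq_zero] at h2
        exact root_toLinear_ne_zero θ h2
    · have hf := form_eq_zero_of_add_ne_zero θ hx hy hγ
      rw [hbr, hf, mul_zero, ite_self, zero_smul, add_zero]
      rcases eq_or_ne ⁅x, y⁆ 0 with h0 | h0
      · left
        rw [h0, loopElt_zero]
      right
      refine ⟨rfl, ?_, fun h1 ↦ ?_⟩
      · rcases hpos with hn | ⟨-, hγ0, hQ⟩
        · change 0 < n at hn
          rcases (by omega : 1 < n ∨ n = 1) with hn | hn
          · exact Or.inl (by change 0 < n - 1; omega)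
          · refine Or.inr ⟨by change n - 1 = 0; omega, ?_, ?_⟩
            · change γ - -θ.1.toLinear ≠ 0
              rwa [sub_neg_eq_add]
            · change γ - -θ.1.toLinear ∈ Qplus b
              rwa [sub_neg_eq_add]
        -- For `n = 0` the bracket would live in degree `γ + θ` with `γ` positive, above the highest
        -- root.
        · have h2 := highest_sub_mem_of_rootSpace hθ hm h0
          rw [sub_add_cancel_right] at h2
          exact absurd (eq_zero_of_Qplus_neg b hQ h2) hγ0
      · have h2 : γ - -θ.1.toLinear = -θ.1.toLinear := congrArg Prod.fst h1
        have h3 : γ = (negRoot θ).1.toLinear + (negRoot θ).1.toLinear := by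
          rw [negRoot_toLinear, sub_eq_iff_eq_add.1 h2]
        rw [h3] at hx
        exact hx0 (rootSpace_two_smul_root _ hx)
  · simp only [simpleDeg, neg_zero, sub_zero] at hm hy hne ⊢
    have hbr := lie_loopElt θ n 0 x y
    rw [add_zero] at hbr
    have hcen : (if n = 0 then (n : ℂ) * form θ x y else 0) = 0 := by
      split_ifs with h0
      · rw [h0]; simp
      · rfl
    rw [hbr, hcen, zero_smul, add_zero]
    rcases eq_or_ne ⁅x, y⁆ 0 with h0 | h0
    · left
      rw [h0, loopElt_zero]
    right
    refine ⟨rfl, ?_, fun h1 ↦ ?_⟩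
    · rcases hpos with hn | ⟨hn, hγ0, hQ⟩
      · exact Or.inl (by change 0 < n - 0; rwa [sub_zero])
      · change n = 0 at hn
        have hγi : γ ≠ i.1.1.toLinear := fun h ↦ hne (by rw [h, hn])
        refine Or.inr ⟨by change n - 0 = 0; rwa [sub_zero], sub_ne_zero.2 hγi, ?_⟩
        change γ - i.1.1.toLinear ∈ Qplus b
        rcases eq_zero_or_exists_root hm h0 with h2 | ⟨δ, hδ⟩
        · rw [← sub_eq_add_neg] at h2
          exact absurd (sub_eq_zero.1 h2) hγi
        rw [← sub_eq_add_neg] at hδ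
        -- If `α_i - γ` were in `Q₊`, the heights of `γ` and `α_i - γ` would sum to `1`; as `γ ≠ 0`,
        -- this gives `γ = α_i`.
        refine hδ ▸ (root_mem_Qplus_or_neg b δ).resolve_right fun hneg ↦ hγi ?_
        rw [hδ, neg_sub] at hneg
        obtain ⟨k, hk, hk0⟩ := heightFun_Qplus b hQ
        obtain ⟨m, hm', hm0⟩ := heightFun_Qplus b hneg
        rw [map_sub, heightFun_simple b i.2, hk] at hm'
        have h3 : k + m = 1 := by
          have : ((k + m : ℕ) : ℂ) = 1 := by push_cast; rw [← hm']; ring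
          exact_mod_cast this
        have h4 : k ≠ 0 := fun h ↦ hγ0 (hk0 h)
        exact (sub_eq_zero.1 (hm0 (by omega))).symm
    · have h2 : γ - i.1.1.toLinear = i.1.1.toLinear := congrArg Prod.fst h1
      rw [sub_eq_iff_eq_add.1 h2] at hx
      exact hx0 (rootSpace_two_smul_root _ hx)

/-- Up to multiples of `k`, iterated brackets on loop elements follow the nilpotent `ad y` of `𝔤`;
one further bracket kills the central part. On `d` two brackets suffice. -/
lemma exists_pow_ad_eq_zero (θ : 𝔥.root) {γ : Dual ℂ 𝔥} (hγ : γ ≠ 0) (p : ℤ)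
    {y : 𝔤} (hy : y ∈ rootSpace 𝔥 γ) (a : AffineKM θ) :
    ∃ k : ℕ, (toEnd ℂ (AffineKM θ) (AffineKM θ) (loopElt θ p y) ^ k) a = 0 := by
  rw [← mem_maxGenEigenspace_zero_iff]
  have hcen : ⁅loopElt θ p y, centralElt θ⁆ = 0 := by rw [← lie_skew, lie_centralElt, neg_zero]
  induction a using affine_induction with
  | loop δ n x hx =>
    rw [mem_maxGenEigenspace_zero_iff]
    have hγ' : (γ : 𝔥 → ℂ) ≠ 0 := fun h ↦ hγ (by ext z; exact congrFun h z)
    obtain ⟨k, hk⟩ := isNilpotent_ad_of_mem_rootSpace 𝔥 hγ' hy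
    have key (j : ℕ) : ∃ c : ℂ, (toEnd ℂ (AffineKM θ) (AffineKM θ) (loopElt θ p y) ^ j)
        (loopElt θ n x) = loopElt θ (n + j * p) ((ad ℂ 𝔤 y ^ j) x) + c • centralElt θ := by
      induction j with
      | zero => exact ⟨0, by simp⟩
      | succ j ih =>
        obtain ⟨c, hc⟩ := ih
        rw [pow_succ', Module.End.mul_apply, hc, toEnd_apply_apply, lie_add, lie_smul, hcen,
          smul_zero, add_zero, lie_loopElt, pow_succ' (ad ℂ 𝔤 y), Module.End.mul_apply, ad_apply,
          show p + (n + j * p) = n + (j + 1 : ℕ) * p by push_cast; ring]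
        exact ⟨_, rfl⟩
    obtain ⟨c, hc⟩ := key k
    refine ⟨k + 1, ?_⟩
    rw [pow_succ', Module.End.mul_apply, hc, hk, LinearMap.zero_apply, loopElt_zero, zero_add,
      toEnd_apply_apply, lie_smul, hcen, smul_zero]
  | central =>
    exact (mem_maxGenEigenspace_zero_iff _ _).2 ⟨1, by rw [pow_one]; exact hcen⟩
  | degree =>
    refine (mem_maxGenEigenspace_zero_iff _ _).2 ⟨2, ?_⟩
    rw [pow_two, Module.End.mul_apply, toEnd_apply_apply, toEnd_apply_apply,
      ← lie_skew _ (degreeElt θ), lie_degreeElt_loopElt, lie_neg, lie_smul, lie_self, smul_zero,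
      neg_zero]
  | smul c a ha => exact Submodule.smul_mem _ c ha
  | add a b ha hb => exact add_mem ha hb

end AffineRoots
end
end AffineLie

namespace AffineLie

open Module LieModule LieAlgebra LieAlgebra.IsKilling

noncomputable section

/-! ### Singular vectors, weights of highest weight modules and simple reflections. -/

section HighestWeight

attribute [local instance 100] LieRing.ofAssociativeRing

set_option linter.unusedSectionVars false

variable {𝔤 : Type*} [LieRing 𝔤] [LieAlgebra ℂ 𝔤] [FiniteDimensional ℂ 𝔤]
  [LieAlgebra.IsSimple ℂ 𝔤] {𝔥 : LieSubalgebra ℂ 𝔤} [𝔥.IsCartanSubalgebra]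
  {b : (rootSystem 𝔥).Base} {θ : 𝔥.root}
  {V : Type*} [AddCommGroup V] [Module ℂ V] [LieRingModule (AffineKM θ) V]
  [LieModule ℂ (AffineKM θ) V]

/-- `v` satisfies `h v = χ(h) v` for `h` in the affine Cartan subalgebra. -/
def HasWeight (θ : 𝔥.root) {V : Type*} [AddCommGroup V] [Module ℂ V]
    [LieRingModule (AffineKM θ) V] (χ : Dual ℂ (𝔥 × ℂ × ℂ)) (v : V) : Prop :=
  ∀ h, ⁅cartanIncl θ h, v⁆ = χ h • v

/-- `v` is killed by all positive root vectors. -/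
def IsSingular (b : (rootSystem 𝔥).Base) (θ : 𝔥.root) {V : Type*} [AddCommGroup V]
    [LieRingModule (AffineKM θ) V] (v : V) : Prop :=
  ∀ (γ : Dual ℂ 𝔥) (n : ℤ), IsPosDeg b (γ, n) → ∀ x ∈ rootSpace 𝔥 γ, ⁅loopElt θ n x, v⁆ = 0

lemma HasWeight.lie_loopElt {χ : Dual ℂ (𝔥 × ℂ × ℂ)} {v : V} (hv : HasWeight θ χ v)
    {d : Dual ℂ 𝔥 × ℤ} {x : 𝔤} (hx : x ∈ rootSpace 𝔥 d.1) :
    HasWeight θ (χ + degWeight d) ⁅loopElt θ d.2 x, v⁆ := by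
  intro h
  have h1 := lie_cartanIncl_loopElt θ d.2 hx h
  rw [leibniz_lie, h1, hv h, smul_lie, lie_smul, LinearMap.add_apply, Prod.mk.eta]
  module

lemma HasWeight.lie_loopElt_pow {χ : Dual ℂ (𝔥 × ℂ × ℂ)} {v : V} (hv : HasWeight θ χ v)
    {d : Dual ℂ 𝔥 × ℤ} {x : 𝔤} (hx : x ∈ rootSpace 𝔥 d.1) (k : ℕ) :
    HasWeight θ (χ + k • degWeight d) ((toEnd ℂ (AffineKM θ) V (loopElt θ d.2 x) ^ k) v) := by
  induction k with
  | zero => simpa using hv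
  | succ k ih =>
    rw [pow_succ', Module.End.mul_apply, toEnd_apply_apply, succ_nsmul, ← add_assoc]
    exact ih.lie_loopElt hx

lemma HasWeight.lie_centralElt {χ : Dual ℂ (𝔥 × ℂ × ℂ)} {v : V} (hv : HasWeight θ χ v) :
    ⁅centralElt θ, v⁆ = χ (0, 1, 0) • v := by
  have := hv (0, 1, 0)
  rwa [cartanIncl_apply, ZeroMemClass.coe_zero, loopElt_zero, zero_smul, add_zero, zero_add,
    one_smul] at this

lemma HasWeight.lie_degreeElt {χ : Dual ℂ (𝔥 × ℂ × ℂ)} {v : V} (hv : HasWeight θ χ v) :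
    ⁅degreeElt θ, v⁆ = χ (0, 0, 1) • v := by
  have := hv (0, 0, 1)
  rwa [cartanIncl_apply, ZeroMemClass.coe_zero, loopElt_zero, zero_smul, zero_add, zero_add,
    one_smul] at this

/-- A weight vector in the span of weight vectors has one of their weights. -/
lemma HasWeight.mem_of_mem_span {S : Set (Dual ℂ (𝔥 × ℂ × ℂ))} {χ : Dual ℂ (𝔥 × ℂ × ℂ)} {v : V}
    (hv : HasWeight θ χ v) (hv0 : v ≠ 0)
    (hspan : v ∈ Submodule.span ℂ {w : V | ∃ ψ ∈ S, HasWeight θ ψ w}) : χ ∈ S := by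
  by_contra hχ
  -- Simultaneous generalised eigenspaces of the commuting Cartan operators are independent. A
  -- vector of weight `χ ∉ S` would lie both in `W χ` and in the sum of the others.
  let W (ψ : 𝔥 × ℂ × ℂ → ℂ) : Submodule ℂ V :=
    ⨅ h, (toEnd ℂ (AffineKM θ) V (cartanIncl θ h)).maxGenEigenspace (ψ h)
  have hW {ψ : Dual ℂ (𝔥 × ℂ × ℂ)} {w : V} (hw : HasWeight θ ψ w) : w ∈ W ψ := by
    refine (Submodule.mem_iInf _).2 fun h ↦ ?_
    refine (Module.End.mem_maxGenEigenspace _ _ _).2 ⟨1, ?_⟩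
    rw [pow_one, LinearMap.sub_apply, toEnd_apply_apply, hw h]
    simp
  have hind : iSupIndep W := by
    refine Module.End.independent_iInf_maxGenEigenspace_of_forall_mapsTo _ fun i j φ ↦
      Module.End.mapsTo_maxGenEigenspace_of_comm ?_ φ
    rw [commute_iff_lie_eq, ← LieHom.map_lie, lie_cartanIncl_cartanIncl, map_zero]
  have hle : Submodule.span ℂ {w : V | ∃ ψ ∈ S, HasWeight θ ψ w} ≤
      ⨆ (ψ : 𝔥 × ℂ × ℂ → ℂ) (_ : ψ ≠ χ), W ψ := by
    refine Submodule.span_le.2 ?_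
    rintro w ⟨ψ, hψ, hw⟩
    have hne : (ψ : 𝔥 × ℂ × ℂ → ℂ) ≠ χ := fun h ↦ hχ (by rwa [← DFunLike.coe_injective h])
    exact Submodule.mem_iSup_of_mem (ψ : 𝔥 × ℂ × ℂ → ℂ) (Submodule.mem_iSup_of_mem hne (hW hw))
  exact hv0 (Submodule.disjoint_def.1 (hind χ) v (hW hv) (hle hspan))

/-- The vectors obtained from `u` by applying root vectors of negative degree; the index
records minus the total degree. -/
inductive Descends (b : (rootSystem 𝔥).Base) (θ : 𝔥.root) {V : Type*} [AddCommGroup V]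
    [LieRingModule (AffineKM θ) V] (u : V) : Dual ℂ 𝔥 × ℤ → V → Prop
  | base : Descends b θ u 0 u
  | step {d : Dual ℂ 𝔥 × ℤ} {w : V} (e : Dual ℂ 𝔥 × ℤ) (x : 𝔤) (hx : x ∈ rootSpace 𝔥 e.1)
      (he : -e ∈ affineQplus b θ) (hw : Descends b θ u d w) :
      Descends b θ u (d - e) ⁅loopElt θ e.2 x, w⁆

lemma Descends.mem {u w : V} {d : Dual ℂ 𝔥 × ℤ} (h : Descends b θ u d w) :
    d ∈ affineQplus b θ := by
  induction h with
  | base => exact zero_mem _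
  | step e x _ he _ ih => rw [sub_eq_add_neg]; exact add_mem ih he

lemma Descends.hasWeight {u w : V} {d : Dual ℂ 𝔥 × ℤ} {χ : Dual ℂ (𝔥 × ℂ × ℂ)}
    (hu : HasWeight θ χ u) (h : Descends b θ u d w) : HasWeight θ (χ - degWeight d) w := by
  induction h with
  | base => simpa using hu
  | step e x hx _ _ ih =>
    have := ih.lie_loopElt hx
    rwa [sub_add, ← map_sub] at this

/-- This replaces a PBW argument: a root vector is moved past the outermost lowering factor. The
commutator may have any degree, so the induction must treat all homogeneous `x` at once. -/
lemma Descends.lie_mem_span (hθ : IsHighestRoot b θ) {u : V} {χ : Dual ℂ (𝔥 × ℂ × ℂ)}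
    (hu : HasWeight θ χ u) (hs : IsSingular b θ u) {d : Dual ℂ 𝔥 × ℤ} {w : V}
    (h : Descends b θ u d w) : ∀ (γ : Dual ℂ 𝔥) (n : ℤ), ∀ x ∈ rootSpace 𝔥 γ,
      ⁅loopElt θ n x, w⁆ ∈ Submodule.span ℂ {w : V | ∃ d, Descends b θ u d w} := by
  induction h with
  | base =>
    intro γ n x hx
    rcases eq_or_ne x 0 with rfl | hx0
    · rw [loopElt_zero, zero_lie]; exact zero_mem _
    rcases degree_trichotomy hθ n hx hx0 with ⟨rfl, rfl⟩ | h | h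
    · obtain ⟨y, rfl⟩ := exists_of_rootSpace_zero hx
      have h1 := hu (y, 0, 0)
      rw [cartanIncl_apply, zero_smul, zero_smul, add_zero, add_zero] at h1
      rw [h1]
      exact Submodule.smul_mem _ _ (Submodule.subset_span ⟨0, Descends.base⟩)
    · rw [hs γ n h x hx]; exact zero_mem _
    · exact Submodule.subset_span ⟨_, Descends.step (γ, n) x hx h Descends.base⟩
  | @step d w e y hy he hw ih =>
    intro γ n x hx
    have hstable {v : V} (hv : v ∈ Submodule.span ℂ {w : V | ∃ d, Descends b θ u d w}) :
        ⁅loopElt θ e.2 y, v⁆ ∈ Submodule.span ℂ {w : V | ∃ d, Descends b θ u d w} := by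
      induction hv using Submodule.span_induction with
      | mem v hv =>
        obtain ⟨d, hd⟩ := hv
        exact Submodule.subset_span ⟨_, Descends.step e y hy he hd⟩
      | zero => rw [lie_zero]; exact zero_mem _
      | add v v' _ _ h h' => rw [lie_add]; exact add_mem h h'
      | smul c v _ h => rw [lie_smul]; exact Submodule.smul_mem _ _ h
    rw [leibniz_lie, lie_loopElt, add_lie, smul_lie, (hw.hasWeight hu).lie_centralElt]
    refine add_mem (add_mem (ih (γ + e.1) (n + e.2) _ (lie_mem_rootSpace_add hx hy)) ?_)
      (hstable (ih γ n x hx))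
    exact Submodule.smul_mem _ _ (Submodule.smul_mem _ _ (Submodule.subset_span ⟨d, hw⟩))

/-- The submodule generated by a singular weight vector. -/
def singularSubmodule (hθ : IsHighestRoot b θ) {u : V} {χ : Dual ℂ (𝔥 × ℂ × ℂ)}
    (hu : HasWeight θ χ u) (hs : IsSingular b θ u) : LieSubmodule ℂ (AffineKM θ) V where
  __ := Submodule.span ℂ {w : V | ∃ d, Descends b θ u d w}
  lie_mem {a v} hv := by
    change v ∈ Submodule.span ℂ {w : V | ∃ d, Descends b θ u d w} at hv
    change ⁅a, v⁆ ∈ Submodule.span ℂ {w : V | ∃ d, Descends b θ u d w}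
    induction hv using Submodule.span_induction with
    | mem v hv =>
      obtain ⟨d, hd⟩ := hv
      have hmem := Submodule.subset_span (R := ℂ) (s := {w : V | ∃ d, Descends b θ u d w}) ⟨d, hd⟩
      induction a using affine_induction with
      | loop γ n x hx => exact hd.lie_mem_span hθ hu hs γ n x hx
      | central => rw [(hd.hasWeight hu).lie_centralElt]; exact Submodule.smul_mem _ _ hmem
      | degree => rw [(hd.hasWeight hu).lie_degreeElt]; exact Submodule.smul_mem _ _ hmem
      | smul c a h => rw [smul_lie]; exact Submodule.smul_mem _ _ h
      | add a a' h h' => rw [add_lie]; exact add_mem h h'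
    | zero => rw [lie_zero]; exact zero_mem _
    | add v v' _ _ h h' => rw [lie_add]; exact add_mem h h'
    | smul c v _ h => rw [lie_smul]; exact Submodule.smul_mem _ _ h

lemma self_mem_singularSubmodule (hθ : IsHighestRoot b θ) {u : V} {χ : Dual ℂ (𝔥 × ℂ × ℂ)}
    (hu : HasWeight θ χ u) (hs : IsSingular b θ u) : u ∈ singularSubmodule hθ hu hs :=
  Submodule.subset_span ⟨0, Descends.base⟩

/-- The weights of the submodule generated by a singular vector of weight `χ` lie in
`χ - Q̂₊`. -/
lemma exists_weight_eq_sub (hθ : IsHighestRoot b θ) {u v : V} {χ ψ : Dual ℂ (𝔥 × ℂ × ℂ)}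
    (hu : HasWeight θ χ u) (hs : IsSingular b θ u) (hv : HasWeight θ ψ v) (hv0 : v ≠ 0)
    (hmem : v ∈ singularSubmodule hθ hu hs) :
    ∃ d ∈ affineQplus b θ, ψ = χ - degWeight d := by
  refine hv.mem_of_mem_span (S := {ψ | ∃ d ∈ affineQplus b θ, ψ = χ - degWeight d}) hv0 ?_
  refine Submodule.span_mono ?_ hmem
  rintro w ⟨d, hd⟩
  exact ⟨_, ⟨d, hd.mem, rfl⟩, hd.hasWeight hu⟩

/-- `V` is irreducible with highest weight `Λ` and highest weight vector `v₀`. -/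
structure IsIrreducibleHighestWeight (b : (rootSystem 𝔥).Base) (θ : 𝔥.root) {V : Type*}
    [AddCommGroup V] [Module ℂ V] [LieRingModule (AffineKM θ) V]
    (Λ : Dual ℂ (𝔥 × ℂ × ℂ)) (v₀ : V) : Prop where
  hasWeight : HasWeight θ Λ v₀
  isSingular : IsSingular b θ v₀
  eq_top : ∀ N : LieSubmodule ℂ (AffineKM θ) V, v₀ ∈ N → N = ⊤
  eq_bot : ∀ N : LieSubmodule ℂ (AffineKM θ) V, v₀ ∉ N → N = ⊥

variable {Λ : Dual ℂ (𝔥 × ℂ × ℂ)} {v₀ : V}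

lemma IsIrreducibleHighestWeight.exists_weight_eq_sub
    (H : IsIrreducibleHighestWeight b θ Λ v₀) (hθ : IsHighestRoot b θ) {v : V}
    {ψ : Dual ℂ (𝔥 × ℂ × ℂ)} (hv : HasWeight θ ψ v) (hv0 : v ≠ 0) :
    ∃ d ∈ affineQplus b θ, ψ = Λ - degWeight d := by
  refine AffineLie.exists_weight_eq_sub hθ H.hasWeight H.isSingular hv hv0 ?_
  rw [H.eq_top _ (self_mem_singularSubmodule hθ H.hasWeight H.isSingular)]
  trivial

/-- If `u` generated `v₀`, then `Λ = Λ - d - e` for some `e` in the affine monoid, and `d + e = 0`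
forces `d = 0`. Hence `u` generates a submodule missing `v₀`, which is zero. -/
lemma IsIrreducibleHighestWeight.eq_zero_of_isSingular
    (H : IsIrreducibleHighestWeight b θ Λ v₀) (hθ : IsHighestRoot b θ) {u : V}
    {d : Dual ℂ 𝔥 × ℤ} (hd : d ∈ affineQplus b θ) (hd0 : d ≠ 0)
    (hu : HasWeight θ (Λ - degWeight d) u) (hs : IsSingular b θ u) : u = 0 := by
  have hbot : singularSubmodule hθ hu hs = ⊥ → u = 0 := fun h ↦ by
    have := self_mem_singularSubmodule hθ hu hs
    rwa [h, LieSubmodule.mem_bot] at this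
  by_cases hmem : v₀ ∈ singularSubmodule hθ hu hs
  -- The structure does not require `v₀ ≠ 0`; if `v₀ = 0`, the whole module vanishes.
  · rcases eq_or_ne v₀ 0 with h0 | h0
    · have h1 := H.eq_top ⊥ (by rw [h0]; exact zero_mem _)
      have h2 : u ∈ (⊤ : LieSubmodule ℂ (AffineKM θ) V) := trivial
      rwa [← h1, LieSubmodule.mem_bot] at h2
    · obtain ⟨e, he, h1⟩ := AffineLie.exists_weight_eq_sub hθ hu hs H.hasWeight h0 hmem
      rw [sub_sub, ← map_add, eq_comm, sub_eq_self] at h1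
      have h2 := degWeight_injective (h1.trans (map_zero _).symm)
      exact absurd (eq_zero_of_affineQplus_add b θ hd he h2) hd0
  · exact hbot (H.eq_bot _ hmem)

lemma simpleDeg_isRoot (i : Option b.support) :
    ∃ α : 𝔥.root, α.1.toLinear = (simpleDeg b θ i).1 := by
  rcases i with _ | i
  · exact ⟨negRoot θ, rfl⟩
  · exact ⟨i.1, rfl⟩

/-- Positive root vectors of degree other than `α_i` can be commuted past `f_i` without leaving that
class (`lie_simple_posDeg`). In degree `α_i` the root space is the line of `e_i`, and the `sl₂`
coefficient `(N + 1)(N - N)` vanishes. -/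
lemma isSingular_pow_simple (hθ : IsHighestRoot b θ) {χ : Dual ℂ (𝔥 × ℂ × ℂ)} {u : V}
    (hu : HasWeight θ χ u) (hs : IsSingular b θ u) (i : Option b.support) {N : ℕ}
    (hN : χ (simpleCo b θ i) = N) {x y : 𝔤} (hx : x ∈ rootSpace 𝔥 (simpleDeg b θ i).1)
    (hy : y ∈ rootSpace 𝔥 (-(simpleDeg b θ i).1 : Dual ℂ 𝔥))
    (t : IsSl2Triple (cartanIncl θ (simpleCo b θ i)) (loopElt θ (simpleDeg b θ i).2 x)
        (loopElt θ (-(simpleDeg b θ i).2) y)) :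
    IsSingular b θ ((toEnd ℂ (AffineKM θ) V (loopElt θ (-(simpleDeg b θ i).2) y) ^ (N + 1)) u) := by
  set f := loopElt θ (-(simpleDeg b θ i).2) y
  have key (k : ℕ) : ∀ (γ : Dual ℂ 𝔥) (n : ℤ), IsPosDeg b (γ, n) → (γ, n) ≠ simpleDeg b θ i →
      ∀ z ∈ rootSpace 𝔥 γ, ⁅loopElt θ n z, (toEnd ℂ (AffineKM θ) V f ^ k) u⁆ = 0 := by
    induction k with
    | zero => intro γ n h _ z hz; exact hs γ n h z hz
    | succ k ih =>
      intro γ n h hne z hz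
      rw [pow_succ', Module.End.mul_apply, toEnd_apply_apply, leibniz_lie, ih γ n h hne z hz,
        lie_zero, add_zero]
      rcases lie_simple_posDeg hθ i hy hz h hne with h0 | ⟨h1, h2, h3⟩
      · rw [h0, zero_lie]
      · rw [h1]
        refine ih (γ - (simpleDeg b θ i).1) (n - (simpleDeg b θ i).2) h2 h3 _ ?_
        rw [sub_eq_add_neg]
        exact lie_mem_rootSpace_add hz hy
  intro γ n hpos z hz
  by_cases hne : (γ, n) = simpleDeg b θ i
  · obtain ⟨α, hα⟩ := simpleDeg_isRoot (θ := θ) i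
    have hγ : γ = (simpleDeg b θ i).1 := congrArg Prod.fst hne
    have hn : n = (simpleDeg b θ i).2 := congrArg Prod.snd hne
    have hfin := finrank_rootSpace_eq_one α.1 (LieSubalgebra.isNonZero_coe_root α)
    have hx0 : x ≠ 0 := fun h ↦ t.e_ne_zero (by rw [h, loopElt_zero])
    have hxα : x ∈ rootSpace 𝔥 α.1 := by rw [← hα] at hx; exact hx
    have hzα : z ∈ rootSpace 𝔥 α.1 := by rw [hγ, ← hα] at hz; exact hz
    obtain ⟨c, hc⟩ := exists_smul_eq_of_finrank_eq_one hfin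
      (x := ⟨x, hxα⟩) (fun h ↦ hx0 (congrArg Subtype.val h)) ⟨z, hzα⟩
    have hc' : z = c • x := (congrArg Subtype.val hc).symm
    have hpos' : IsPosDeg b ((simpleDeg b θ i).1, (simpleDeg b θ i).2) := hne ▸ hpos
    rw [hc', hn, loopElt_smul, smul_lie, lie_e_pow_succ_f t (hu _), hN, hs _ _ hpos' x hx]
    simp
  · exact key (N + 1) γ n hpos hne z hz

/-- Reflection of weights in the affine simple roots. -/
lemma IsIrreducibleHighestWeight.exists_reflected
    (H : IsIrreducibleHighestWeight b θ Λ v₀) (hθ : IsHighestRoot b θ) (i : Option b.support)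
    {N : ℕ} (hN : Λ (simpleCo b θ i) = N) {v : V} {ψ : Dual ℂ (𝔥 × ℂ × ℂ)}
    (hv : HasWeight θ ψ v) (hv0 : v ≠ 0) {n : ℕ} (hn : ψ (simpleCo b θ i) = -n) :
    ∃ w : V, w ≠ 0 ∧ HasWeight θ (ψ + n • degWeight (simpleDeg b θ i)) w := by
  obtain ⟨x, hx, y, hy, t⟩ := exists_simple_sl2 b θ i
  -- The witness is `e_i ^ n v`, whose weight is `s_i ψ`.
  refine ⟨_, fun h0 ↦ hv0 ?_, hv.lie_loopElt_pow hx n⟩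
  set f := loopElt θ (-(simpleDeg b θ i).2) y with hf
  have had : ∀ a : AffineKM θ, ∃ k : ℕ, (toEnd ℂ (AffineKM θ) (AffineKM θ) f ^ k) a = 0 := by
    obtain ⟨α, hα⟩ := simpleDeg_isRoot (θ := θ) i
    refine fun a ↦ exists_pow_ad_eq_zero θ ?_ _ hy a
    rw [← hα, neg_ne_zero]
    exact root_toLinear_ne_zero α
  have hv₀ : (toEnd ℂ (AffineKM θ) V f ^ (N + 1)) v₀ = 0 := by
    have hs := isSingular_pow_simple hθ H.hasWeight H.isSingular i hN hx hy t
    have hw := H.hasWeight.lie_loopElt_pow (d := -simpleDeg b θ i) hy (N + 1)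
    rw [← map_nsmul, smul_neg, map_neg, ← sub_eq_add_neg] at hw
    refine H.eq_zero_of_isSingular hθ (nsmul_mem (simpleDeg_mem b θ i) _) (fun h ↦ ?_) hw hs
    have h1 := congrArg (affineHeight b θ) h
    rw [map_nsmul, affineHeight_simpleDeg, map_zero, nsmul_one] at h1
    exact N.succ_ne_zero (by exact_mod_cast h1)
  -- The vectors on which `f_i` acts nilpotently form a submodule containing the generator `v₀`, so
  -- they exhaust `V`.
  have hmem : v ∈ nilpotentVectors (M := V) f had := by
    rw [H.eq_top _ ((mem_nilpotentVectors had v₀).2 ⟨N + 1, hv₀⟩)]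
    trivial
  obtain ⟨k, hk⟩ := (mem_nilpotentVectors had v).1 hmem
  -- In the opposite triple the roles of `e_i` and `f_i` are exchanged and `v` has weight `n`; only
  -- the local nilpotency of `f_i` is needed.
  refine eq_zero_of_pow_e_of_pow_f t.symm (c := n) (n := n) ?_ le_rfl hk h0
  rw [neg_lie, hv, hn, neg_smul, neg_neg]

end HighestWeight
end
end AffineLie

namespace AffineLie

open Module LieModule LieAlgebra LieAlgebra.IsKilling

noncomputable section

/-! ### The norm inequality, positivity of `ρ̂` and the comparison of weights. -/

section Norm

set_option linter.unusedSectionVars false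

variable {𝔤 : Type*} [LieRing 𝔤] [LieAlgebra ℂ 𝔤] [FiniteDimensional ℂ 𝔤]
  [LieAlgebra.IsSimple ℂ 𝔤] {𝔥 : LieSubalgebra ℂ 𝔤} [𝔥.IsCartanSubalgebra]
  {b : (rootSystem 𝔥).Base} {θ : 𝔥.root}

lemma affineWeight_sub_degWeight (μ : Dual ℂ 𝔥) (ℓ : ℕ) (z : ℂ) (d : Dual ℂ 𝔥 × ℤ) :
    affineWeight μ ℓ z - degWeight d = affineWeight (μ - d.1) ℓ (z - d.2) := by
  refine LinearMap.ext fun h ↦ ?_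
  rw [LinearMap.sub_apply, affineWeight_apply, affineWeight_apply, degWeight_apply,
    LinearMap.sub_apply]
  ring

/-- The pairing of a weight of level `ℓ` with a degree. -/
def affinePair (θ : 𝔥.root) (ℓ : ℕ) (μ : Dual ℂ 𝔥) : Dual ℂ 𝔥 × ℤ →+ ℂ where
  toFun d := dualForm θ μ d.1 + ℓ * d.2
  map_zero' := by simp
  map_add' d e := by simp; ring

lemma affinePair_apply (ℓ : ℕ) (μ : Dual ℂ 𝔥) (d : Dual ℂ 𝔥 × ℤ) :
    affinePair θ ℓ μ d = dualForm θ μ d.1 + ℓ * d.2 := rfl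

/-- This is `(Λ, α_i) = Λ(α_i^∨) (α_i, α_i) / 2`. The coordinate `z` is arbitrary because simple
coroots have no `d`-component. -/
lemma affinePair_simpleDeg (ℓ : ℕ) (μ : Dual ℂ 𝔥) (z : ℂ) (i : Option b.support) :
    affinePair θ ℓ μ (simpleDeg b θ i) = affineWeight μ ℓ z (simpleCo b θ i) *
      (dualForm θ (simpleDeg b θ i).1 (simpleDeg b θ i).1 / 2) := by
  rw [affinePair_apply, affineWeight_apply]
  rcases i with _ | i
  · simp only [simpleDeg, simpleCo, map_neg, LinearMap.neg_apply, neg_neg,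
      dualForm_highest_right]
    have h2 : (θ.1.toLinear : Dual ℂ 𝔥) (coroot θ.1) = 2 :=
      root_apply_coroot (LieSubalgebra.isNonZero_coe_root θ)
    rw [h2]
    push_cast
    ring
  · simp only [simpleDeg, simpleCo]
    rw [dualForm_root_right]
    push_cast
    ring

open scoped ComplexOrder in
lemma dualForm_simpleDeg_pos (i : Option b.support) :
    0 < dualForm θ (simpleDeg b θ i).1 (simpleDeg b θ i).1 := by
  obtain ⟨α, hα⟩ := simpleDeg_isRoot (θ := θ) i
  rw [← hα]
  exact dualForm_root_pos θ α

open scoped ComplexOrder in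
lemma affinePair_nonneg {ℓ : ℕ} {μ : Dual ℂ 𝔥} {z : ℂ}
    (hdom : ∀ i, ∃ N : ℕ, affineWeight μ ℓ z (simpleCo b θ i) = N) {d : Dual ℂ 𝔥 × ℤ}
    (hd : d ∈ affineQplus b θ) : 0 ≤ affinePair θ ℓ μ d := by
  induction hd using AddSubmonoid.closure_induction with
  | mem x hx =>
    obtain ⟨i, rfl⟩ := hx
    obtain ⟨N, hN⟩ := hdom i
    rw [affinePair_simpleDeg ℓ μ z i, hN]
    exact mul_nonneg (Nat.cast_nonneg N) (div_nonneg (dualForm_simpleDeg_pos i).le two_pos.le)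
  | zero => rw [map_zero]
  | add x y _ _ hx hy => rw [map_add]; exact add_nonneg hx hy

variable {V : Type*} [AddCommGroup V] [Module ℂ V] [LieRingModule (AffineKM θ) V]
  [LieModule ℂ (AffineKM θ) V]

open scoped ComplexOrder in
/-- The weights of an irreducible module with dominant integral highest weight have norm at most
that of the highest weight. -/
lemma IsIrreducibleHighestWeight.norm_le (hθ : IsHighestRoot b θ) {μ : Dual ℂ 𝔥} {ℓ : ℕ} {z : ℂ}
    {v₀ : V} (H : IsIrreducibleHighestWeight b θ (affineWeight μ ℓ z) v₀)
    (hdom : ∀ i, ∃ N : ℕ, affineWeight μ ℓ z (simpleCo b θ i) = N) (k : ℕ) :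
    ∀ d ∈ affineQplus b θ, affineHeight b θ d = k →
      (∃ v : V, v ≠ 0 ∧ HasWeight θ (affineWeight μ ℓ z - degWeight d) v) →
      0 ≤ 2 * affinePair θ ℓ μ d - dualForm θ d.1 d.1 := by
  induction k using Nat.strong_induction_on with
  | _ k ih =>
  rintro d hd hk ⟨v, hv0, hv⟩
  have hint (i : Option b.support) :
      ∃ c : ℤ, (affineWeight μ ℓ z - degWeight d) (simpleCo b θ i) = c := by
    obtain ⟨N, hN⟩ := hdom i
    obtain ⟨c, hc⟩ := degWeight_simpleCo_int b θ hd i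
    exact ⟨N - c, by rw [LinearMap.sub_apply, hN, hc]; push_cast; ring⟩
  by_cases hneg : ∃ (i : Option b.support) (n : ℕ), 0 < n ∧
      (affineWeight μ ℓ z - degWeight d) (simpleCo b θ i) = -n
  · obtain ⟨i, n, hn, hpair⟩ := hneg
    obtain ⟨N, hN⟩ := hdom i
    obtain ⟨w, hw0, hw⟩ := H.exists_reflected hθ i hN hv hv0 hpair
    obtain ⟨e, he, hwe⟩ := H.exists_weight_eq_sub hθ hw hw0
    -- Reflecting replaces `d` by `d - n α_i`, whose height is smaller by `n > 0`.
    have hde : e = d - n • simpleDeg b θ i := by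
      refine degWeight_injective ?_
      rw [map_sub, map_nsmul]
      rw [eq_comm, ← sub_eq_zero] at hwe ⊢
      rw [← hwe]
      abel
    obtain ⟨j, hj, -⟩ := affineHeight_affineQplus b θ he
    have hjk : k = j + n := by
      have h1 := congrArg (affineHeight b θ) hde
      rw [map_sub, map_nsmul, affineHeight_simpleDeg, hj, hk, nsmul_one] at h1
      have : ((j + n : ℕ) : ℂ) = k := by push_cast; rw [h1]; ring
      exact_mod_cast this.symm
    have key := ih j (by omega) e he hj ⟨w, hw0, hwe ▸ hw⟩
    -- Here `2(Λ - d, α_i) = -n (α_i, α_i)`, which is exactly what makes the norm defects of `d` and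
    -- `e` equal.
    have h1 := affinePair_simpleDeg (b := b) (θ := θ) ℓ (μ - d.1) (z - d.2) i
    rw [← affineWeight_sub_degWeight, hpair, affinePair_apply, map_sub, LinearMap.sub_apply] at h1
    rw [affinePair_apply] at key ⊢
    refine key.trans_eq ?_
    rw [hde]
    simp only [Prod.fst_sub, Prod.snd_sub, Prod.smul_fst, Prod.smul_snd, map_sub, map_nsmul,
      LinearMap.sub_apply, LinearMap.smul_apply, nsmul_eq_mul]
    rw [dualForm_comm θ (simpleDeg b θ i).1 d.1]
    push_cast
    linear_combination (-2 * n : ℂ) * h1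
  · push Not at hneg
    have hdom' (i : Option b.support) :
        ∃ N : ℕ, affineWeight (μ - d.1) ℓ (z - d.2) (simpleCo b θ i) = N := by
      rw [← affineWeight_sub_degWeight]
      obtain ⟨c, hc⟩ := hint i
      rcases lt_or_ge c 0 with h | h
      · refine absurd ?_ (hneg i (-c).toNat (by omega))
        have : ((-c).toNat : ℤ) = -c := Int.toNat_of_nonneg (by omega)
        have h2 : (((-c).toNat : ℤ) : ℂ) = -c := by rw [this]; push_cast; rfl
        rw [hc]
        rw [Int.cast_natCast] at h2
        rw [h2, neg_neg]
      · obtain ⟨N, rfl⟩ := Int.eq_ofNat_of_zero_le h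
        exact ⟨N, by simpa using hc⟩
    -- For dominant `Λ - d`, the defect `2(Λ, d) - (d, d)` splits as `(Λ, d) + (Λ - d, d)`.
    have h1 := add_nonneg (affinePair_nonneg hdom hd) (affinePair_nonneg hdom' hd)
    refine h1.trans_eq ?_
    rw [affinePair_apply, affinePair_apply, map_sub, LinearMap.sub_apply]
    ring

open scoped ComplexOrder in
lemma dualCoxeter_pos (θ : 𝔥.root) : 0 < dualCoxeter θ := by
  rw [dualCoxeter_eq_scale, formScale, inv_div]
  exact div_pos (div_pos (killing_coroot_pos θ) two_pos) two_pos

open scoped ComplexOrder in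
/-- The affine Weyl vector pairs positively with nonzero elements of `Q̂₊`. -/
lemma rho_pair_pos (hθ : IsHighestRoot b θ) {d : Dual ℂ 𝔥 × ℤ} (hd : d ∈ affineQplus b θ) :
    d = 0 ∨ 0 < dualForm θ d.1 (rho b) + dualCoxeter θ * d.2 := by
  induction hd using AddSubmonoid.closure_induction with
  | mem x hx =>
    obtain ⟨i, rfl⟩ := hx
    right
    rw [dualForm_comm]
    rcases i with _ | i
    · simp only [simpleDeg, map_neg, dualForm_highest_right]
      -- At `α₀` the pairing is `h^∨ - ρ(θ^∨) = 1`.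
      rw [dualCoxeter_eq hθ]
      simp
    · simp only [simpleDeg]
      rw [dualForm_root_right, rho_simple_coroot b i.2]
      simpa using dualForm_root_pos θ i.1
  | zero => exact Or.inl rfl
  | add x y _ _ hx hy =>
    have h : dualForm θ (x + y).1 (rho b) + dualCoxeter θ * ((x + y).2 : ℤ) =
        (dualForm θ x.1 (rho b) + dualCoxeter θ * x.2) +
        (dualForm θ y.1 (rho b) + dualCoxeter θ * y.2) := by
      simp; ring
    rcases hx with rfl | hx
    · simpa using hy
    rcases hy with rfl | hy
    · right; simpa using hx
    · right
      rw [h]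
      exact add_pos hx hy

-- The relation `(Λ + ρ̂, Λ + ρ̂) = (ρ, ρ)` is encoded by `hcw`: the `d'`-coordinate `-h_{λ,ℓ}`
-- cancels `⟨λ, λ + 2ρ⟩`.
open scoped ComplexOrder in
lemma IsIrreducibleHighestWeight.weight_eq (hθ : IsHighestRoot b θ) {μ μ' : Dual ℂ 𝔥} {ℓ m : ℕ}
    {v₀ v : V}
    (H : IsIrreducibleHighestWeight b θ (affineWeight μ ℓ (-conformalWeight b θ μ ℓ)) v₀)
    (hdom : ∀ i, ∃ N : ℕ,
      affineWeight μ ℓ (-conformalWeight b θ μ ℓ) (simpleCo b θ i) = N) (hv0 : v ≠ 0)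
    (hv : HasWeight θ (affineWeight μ' ℓ (-(conformalWeight b θ μ' ℓ - m))) v) :
    affineWeight μ' ℓ (-(conformalWeight b θ μ' ℓ - m)) =
      affineWeight μ ℓ (-conformalWeight b θ μ ℓ) := by
  obtain ⟨d, hd, heq⟩ := H.exists_weight_eq_sub hθ hv hv0
  obtain ⟨k, hk, -⟩ := affineHeight_affineQplus b θ hd
  have hnorm := H.norm_le hθ hdom k d hd hk ⟨v, hv0, heq ▸ hv⟩
  have hpos : (0 : ℂ) < ℓ + dualCoxeter θ :=
    add_pos_of_nonneg_of_pos (Nat.cast_nonneg ℓ) (dualCoxeter_pos θ)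
  have hcw (ν : Dual ℂ 𝔥) : 2 * (ℓ + dualCoxeter θ) * conformalWeight b θ ν ℓ =
      dualForm θ ν ν + 2 * dualForm θ ν (rho b) := by
    rw [conformalWeight, mul_div_cancel₀ _ (mul_ne_zero two_ne_zero hpos.ne'), map_add, map_smul,
      smul_eq_mul]
  have heq' := heq
  rw [affineWeight_sub_degWeight] at heq'
  have h1 : μ' = μ - d.1 := by
    refine LinearMap.ext fun x ↦ ?_
    have := LinearMap.congr_fun heq' (x, 0, 0)
    simpa [affineWeight_apply] using this
  have h2 : -(conformalWeight b θ μ' ℓ - m) = -conformalWeight b θ μ ℓ - d.2 := by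
    have := LinearMap.congr_fun heq' (0, 0, 1)
    simpa only [affineWeight_apply, map_zero, mul_zero, mul_one, zero_add, add_zero] using this
  rcases rho_pair_pos hθ hd with rfl | hρ
  · rw [heq, map_zero, sub_zero]
  exfalso
  have hm : (0 : ℂ) ≤ 2 * (ℓ + dualCoxeter θ) * m :=
    mul_nonneg (mul_nonneg two_pos.le hpos.le) (Nat.cast_nonneg m)
  -- The sum of `2(ℓ + h^∨) m`, the norm defect and `2(d, ρ̂)` is positive, yet comparing `hcw` at
  -- `μ` and `μ - d.1` shows that it is `0`.
  have hsum := add_pos_of_nonneg_of_pos (add_nonneg hm hnorm) (mul_pos two_pos hρ)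
  refine hsum.ne' ?_
  have c1 := hcw μ
  have c2 := hcw μ'
  rw [h1] at c2 h2
  simp only [map_sub, LinearMap.sub_apply] at c2
  rw [dualForm_comm θ d.1 μ] at c2
  rw [affinePair_apply]
  linear_combination (2 * (ℓ + dualCoxeter θ)) * h2 + c2 - c1

lemma apply_coroot_int {μ : Dual ℂ 𝔥} (hμ : μ ∈ dominantWeights b θ) (α : 𝔥.root) :
    ∃ n : ℤ, μ (coroot α.1) = n := by
  have h := b.coroot_mem_span_int α
  rw [rootSystem_coroot_apply] at h
  generalize (coroot α.1 : 𝔥) = y at h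
  induction h using Submodule.span_induction with
  | mem x hx =>
    obtain ⟨i, hi, rfl⟩ := hx
    obtain ⟨n, hn⟩ := (dominantWeights_iff b θ μ).1 hμ i hi
    exact ⟨n, by simpa using hn⟩
  | zero => exact ⟨0, by simp⟩
  | add x y _ _ hx hy =>
    obtain ⟨n, hn⟩ := hx
    obtain ⟨k, hk⟩ := hy
    exact ⟨n + k, by simp [hn, hk]⟩
  | smul c x _ hx =>
    obtain ⟨n, hn⟩ := hx
    exact ⟨c * n, by simp [hn]⟩

lemma affineWeight_dominant {μ : Dual ℂ 𝔥} {ℓ : ℕ} (hμ : μ ∈ dominantWeights b θ)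
    (hμℓ : (dualForm θ μ θ.1.toLinear).re ≤ ℓ) (z : ℂ) (i : Option b.support) :
    ∃ N : ℕ, affineWeight μ ℓ z (simpleCo b θ i) = N := by
  rw [affineWeight_apply]
  rcases i with _ | i
  -- The coroot `θ^∨` is an integral combination of simple coroots, so `⟨μ, θ⟩ = μ(θ^∨)` is an
  -- integer. The bound on its real part then makes `ℓ - μ(θ^∨)`, the value on `k - θ^∨`, a natural
  -- number.
  · obtain ⟨n, hn⟩ := apply_coroot_int hμ θ
    rw [dualForm_highest_right, hn, Complex.intCast_re] at hμℓ
    have h : n ≤ ℓ := by exact_mod_cast hμℓ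
    refine ⟨(ℓ - n).toNat, ?_⟩
    have h1 : (((ℓ - n).toNat : ℤ) : ℂ) = ((ℓ - n : ℤ) : ℂ) := by
      rw [Int.toNat_of_nonneg (by omega)]
    rw [Int.cast_natCast] at h1
    rw [h1]
    simp only [simpleCo, map_neg, hn]
    push_cast
    ring
  · obtain ⟨n, hn⟩ := (dominantWeights_iff b θ μ).1 hμ i i.2
    exact ⟨n, by simpa [simpleCo] using hn⟩

end Norm

/-! ### Passage between modules over a Lie algebra and over its enveloping algebra. -/

section Enveloping

attribute [local instance 100] LieRing.ofAssociativeRing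

variable {L V : Type*} [LieRing L] [LieAlgebra ℂ L] [AddCommGroup V]
  [Module (UniversalEnvelopingAlgebra ℂ L) V]

/-- A module over the enveloping algebra is a module over the Lie algebra. -/
abbrev envelopingLieRingModule : LieRingModule L V where
  bracket a v := UniversalEnvelopingAlgebra.ι ℂ a • v
  add_lie a a' v := by
    rw [map_add, add_smul]
  lie_add a v w := smul_add _ v w
  leibniz_lie a a' v := by
    change UniversalEnvelopingAlgebra.ι ℂ a • UniversalEnvelopingAlgebra.ι ℂ a' • v =
      UniversalEnvelopingAlgebra.ι ℂ ⁅a, a'⁆ • v +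
      UniversalEnvelopingAlgebra.ι ℂ a' • UniversalEnvelopingAlgebra.ι ℂ a • v
    rw [LieHom.map_lie, LieRing.of_associative_ring_bracket, sub_smul, mul_smul, mul_smul,
      sub_add_cancel]

attribute [local instance] envelopingLieRingModule

variable [Module ℂ V] [IsScalarTower ℂ (UniversalEnvelopingAlgebra ℂ L) V]

lemma enveloping_lieModule : LieModule ℂ L V where
  smul_lie c a v := by
    change UniversalEnvelopingAlgebra.ι ℂ (c • a) • v = c • UniversalEnvelopingAlgebra.ι ℂ a • v
    rw [map_smul, smul_assoc]
  lie_smul c a v := by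
    change UniversalEnvelopingAlgebra.ι ℂ a • c • v = c • UniversalEnvelopingAlgebra.ι ℂ a • v
    rw [← algebraMap_smul (UniversalEnvelopingAlgebra ℂ L) c v,
      ← algebraMap_smul (UniversalEnvelopingAlgebra ℂ L) c (_ • v), ← mul_smul, ← mul_smul,
      Algebra.commutes]

/-- A Lie submodule is stable under the enveloping algebra. -/
lemma enveloping_smul_mem (N : LieSubmodule ℂ L V) (u : UniversalEnvelopingAlgebra ℂ L) {v : V}
    (hv : v ∈ N) : u • v ∈ N := by
  let S : Subalgebra ℂ (UniversalEnvelopingAlgebra ℂ L) :=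
    { carrier := {u | ∀ v ∈ N, u • v ∈ N}
      mul_mem' := fun {a c} ha hc v hv ↦ by rw [mul_smul]; exact ha _ (hc v hv)
      add_mem' := fun {a c} ha hc v hv ↦ by rw [add_smul]; exact add_mem (ha v hv) (hc v hv)
      algebraMap_mem' := fun c v hv ↦ by rw [algebraMap_smul]; exact N.smul_mem c hv }
  let g : L →ₗ⁅ℂ⁆ S :=
    { toFun := fun a ↦ ⟨UniversalEnvelopingAlgebra.ι ℂ a, fun v hv ↦ N.lie_mem hv⟩
      map_add' := fun a c ↦ Subtype.ext (map_add (UniversalEnvelopingAlgebra.ι ℂ) a c)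
      map_smul' := fun c a ↦ Subtype.ext (map_smul (UniversalEnvelopingAlgebra.ι ℂ) c a)
      map_lie' := fun {a c} ↦ Subtype.ext (LieHom.map_lie _ a c) }
  -- The stabiliser `S` of `N` is a subalgebra containing the image of `L`. By the universal
  -- property the identity factors through `S`, so `S` is everything.
  have h : S.val.comp (UniversalEnvelopingAlgebra.lift ℂ g) = AlgHom.id ℂ _ := by
    refine UniversalEnvelopingAlgebra.hom_ext ℂ (LieHom.ext fun a ↦ ?_)
    change ((UniversalEnvelopingAlgebra.lift ℂ g (UniversalEnvelopingAlgebra.ι ℂ a) : S) :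
      UniversalEnvelopingAlgebra ℂ L) = UniversalEnvelopingAlgebra.ι ℂ a
    rw [UniversalEnvelopingAlgebra.lift_ι_apply]
    rfl
  have hu : ((UniversalEnvelopingAlgebra.lift ℂ g u : S) : UniversalEnvelopingAlgebra ℂ L) = u :=
    AlgHom.congr_fun h u
  rw [← hu]
  exact (UniversalEnvelopingAlgebra.lift ℂ g u).2 v hv

end Enveloping

/-! ### The standard module as an irreducible highest weight module. -/

section Standard

variable {𝔤 : Type*} [LieRing 𝔤] [LieAlgebra ℂ 𝔤] [FiniteDimensional ℂ 𝔤]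
  [LieAlgebra.IsSimple ℂ 𝔤] {𝔥 : LieSubalgebra ℂ 𝔤} [𝔥.IsCartanSubalgebra]

attribute [local instance] envelopingLieRingModule enveloping_lieModule

/-- For irreducibility, a submodule missing the highest weight vector has a proper preimage in the
Verma module, and this preimage lies in the sum that is divided out. Properness of that sum plays no
role. -/
lemma standardModule_isIrreducibleHighestWeight (b : (rootSystem 𝔥).Base) (θ : 𝔥.root)
    (Λ : Dual ℂ (𝔥 × ℂ × ℂ)) :
    IsIrreducibleHighestWeight b θ (V := StandardModule b θ Λ) Λ
      (Submodule.Quotient.mk (Submodule.Quotient.mk 1)) := by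
  have hmk (u : AffineU θ) : u • (Submodule.Quotient.mk (Submodule.Quotient.mk 1) :
      StandardModule b θ Λ) = Submodule.Quotient.mk (Submodule.Quotient.mk u) := by
    rw [← Submodule.Quotient.mk_smul, ← Submodule.Quotient.mk_smul, smul_eq_mul, mul_one]
  have hzero {u : AffineU θ} (hu : u ∈ vermaIdeal b θ Λ) :
      u • (Submodule.Quotient.mk (Submodule.Quotient.mk 1) : StandardModule b θ Λ) = 0 := by
    rw [hmk, (Submodule.Quotient.mk_eq_zero _).2 hu, Submodule.Quotient.mk_zero]
  refine ⟨fun h ↦ ?_, fun γ n hpos x hx ↦ ?_, fun N hN ↦ ?_, fun N hN ↦ ?_⟩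
  · have h1 := hzero (Submodule.subset_span (Or.inr ⟨h, rfl⟩))
    rw [sub_smul, sub_eq_zero, algebraMap_smul] at h1
    exact h1
  · rcases eq_or_ne x 0 with rfl | hx0
    · rw [loopElt_zero, zero_lie]
    refine hzero (Submodule.subset_span (Or.inl ⟨_, ?_, rfl⟩))
    rcases hpos with hn | ⟨hn, hγ0, hQ⟩
    · exact Or.inr ⟨n, hn, x, rfl⟩
    · obtain ⟨α, rfl⟩ := (eq_zero_or_exists_root hx hx0).resolve_left hγ0
      change n = 0 at hn
      exact Or.inl ⟨α, hQ, x, hx, by rw [hn]⟩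
  · refine eq_top_iff.2 fun v _ ↦ ?_
    obtain ⟨w, rfl⟩ := Submodule.Quotient.mk_surjective _ v
    obtain ⟨u, rfl⟩ := Submodule.Quotient.mk_surjective _ w
    rw [← hmk]
    exact enveloping_smul_mem N u hN
  · let W : Submodule (AffineU θ) (StandardModule b θ Λ) :=
      { N.toSubmodule with smul_mem' := fun u v hv ↦ enveloping_smul_mem N u hv }
    have hW : W.comap (Submodule.mkQ _) ≠ ⊤ := fun h ↦ hN <| by
      have : (Submodule.Quotient.mk 1 : VermaModule b θ Λ) ∈ W.comap (Submodule.mkQ _) := by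
        rw [h]; trivial
      exact this
    refine (LieSubmodule.eq_bot_iff _).2 fun v hv ↦ ?_
    obtain ⟨w, rfl⟩ := Submodule.Quotient.mk_surjective _ v
    have hw : w ∈ W.comap (Submodule.mkQ _) := hv
    exact (Submodule.Quotient.mk_eq_zero _).2 (le_sSup (a := W.comap (Submodule.mkQ _)) hW hw)

lemma standardModule_weight_eq {b : (rootSystem 𝔥).Base} {θ : 𝔥.root} (hθ : IsHighestRoot b θ)
    {ℓ m : ℕ} {μ μ' : Dual ℂ 𝔥} (hμ : μ ∈ dominantWeights b θ)
    (hμℓ : (dualForm θ μ θ.1.toLinear).re ≤ ℓ)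
    (hweight : IsWeightOf θ (StandardModule b θ (affineWeight μ ℓ (-conformalWeight b θ μ ℓ)))
      (affineWeight μ' ℓ (-(conformalWeight b θ μ' ℓ - m)))) :
    affineWeight μ' ℓ (-(conformalWeight b θ μ' ℓ - m)) =
      affineWeight μ ℓ (-conformalWeight b θ μ ℓ) := by
  obtain ⟨v, hv0, hv⟩ := hweight
  refine (standardModule_isIrreducibleHighestWeight b θ _).weight_eq hθ
    (affineWeight_dominant hμ hμℓ _) hv0 fun h ↦ ?_
  have := hv h
  rwa [algebraMap_smul] at this

end Standard
end
end AffineLie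

theorem theorem2p4 {𝔤 : Type*} [LieRing 𝔤] [LieAlgebra ℂ 𝔤] [FiniteDimensional ℂ 𝔤]
    [LieAlgebra.IsSimple ℂ 𝔤] (𝔥 : LieSubalgebra ℂ 𝔤) [𝔥.IsCartanSubalgebra]
    (b : (LieAlgebra.IsKilling.rootSystem 𝔥).Base)
    (θ : 𝔥.root) (hθ : AffineLie.IsHighestRoot b θ)
    (ℓ : ℕ) (μ : Module.Dual ℂ 𝔥) (hμ : μ ∈ AffineLie.dominantWeights b θ)
    (hμℓ : (AffineLie.dualForm θ μ θ.1.toLinear).re ≤ ℓ)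
    (μ' : Module.Dual ℂ 𝔥) (hμ' : μ' ∈ AffineLie.dominantWeights b θ) (m : ℕ)
    (hweight : AffineLie.IsWeightOf θ
      (AffineLie.StandardModule b θ
        (AffineLie.affineWeight μ ℓ (-AffineLie.conformalWeight b θ μ ℓ)))
      (AffineLie.affineWeight μ' ℓ (-(AffineLie.conformalWeight b θ μ' ℓ - m)))) :
    AffineLie.affineWeight μ' ℓ (-(AffineLie.conformalWeight b θ μ' ℓ - m)) =
      AffineLie.affineWeight μ ℓ (-AffineLie.conformalWeight b θ μ ℓ) :=
  AffineLie.standardModule_weight_eq hθ hμ hμℓ hweight
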